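/- Use the Fourier transform $\hat g(\xi)=(2\pi)^{-1/2}\int_{\mathbb R}g(x)e^{-ix\xi}\,dx$, extended to tempered distributions. A function $\phi:\mathbb R\to\mathbb R$ satisfies the interpolating conditions if it is slowly increasing (locally integrable, of at most polynomial growth at infinity), its distributional Fourier transform coincides on $\mathbb R\setminus\{0\}$ with a real-valued function $\hat\phi\in C^1(\mathbb R\setminus\{0\})$, $\hat\phi\ge 0$ on $\mathbb R\setminus\{0\}$, $\hat\phi\ge m$ on $[-\pi,\pi]\setminus\{0\}$ for some $m>0$, and for some $\epsilon>0$ both $\hat\phi(\xi)$ and $\hat\phi'(\xi)$ are $O(|\xi|^{-(1+\epsilon)})$ as $|\xi|\to\infty$. Let $A\subset(0,\infty)$ be unbounded. A family $\{\phi_\alpha:\alpha\in A\}$ is a spline-like family of cardinal interpolators if (B1) every $\phi_\alpha$ satisfies the interpolating conditions; (B2) there is $C<\infty$ such that for all $\alpha\in A$ $$\sum_{j\in\mathbb Z}\sum_{k\ne j}\int_{-\pi}^{\pi}\left|\frac{\hat\phi_\alpha(\xi+2\pi j)}{\hat\phi_\alpha(\xi)}\cdot\frac{\hat\phi_\alpha'(\xi+2\pi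 k)}{\hat\phi_\alpha(\xi)}\right|d\xi\le C;$$ (B3) for every integer $j\ne0$, $\displaystyle\lim_{\alpha\to\infty,\ \alpha\in A}\frac{\hat\phi_\alpha(\xi+2\pi j)}{\hat\phi_\alpha(\xi)}=0$ for almost every $|\xi|\le\pi$; (B4) there is a summable sequence $\{M_j\}_{j\in\mathbb Z}$ of real numbers with $\hat\phi_\alpha(\xi+2\pi j)/\hat\phi_\alpha(\xi)\le M_j$ for all $j\ne0$, $\alpha\in A$ and $0<|\xi|\le\pi$. For such $\phi_\alpha$ let $L_{\phi_\alpha}$ be the fundamental function $$L_{\phi_\alpha}(x)=(2\pi)^{-1/2}\int_{\mathbb R}\hat L_{\phi_\alpha}(\xi)e^{ix\xi}\,d\xi,\qquad \hat L_{\phi_\alpha}(\xi)=(2\pi)^{-1/2}\frac{\hat\phi_\alpha(\xi)}{\sum_{j\in\mathbb Z}\hat\phi_\alpha(\xi+2\pi j)},$$ and for $f=\{f(k)\}_{k\in\mathbb Z}\subset\mathbb C$ put $$\mathscr I_{\phi_\alpha}[f](x)=\sum_{j\in\mathbb Z}f(j)L_{\phi_\alpha}(x-j),\qquad \mathscr W[f](x)=\sum_{k\in\mathbb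 Z}f(k)\frac{\sin(\pi(x-k))}{\pi(x-k)},$$ where the last quotient is read as $1$ at $x=k$. Proposition. Let $\{\phi_\alpha:\alpha\in A\}$ be a spline-like family of cardinal interpolators, $1<p<\infty$ and $f\in l^p(\mathbb Z)$. Then for every $\alpha\in A$ the series defining $\mathscr I_{\phi_\alpha}[f]$ and $\mathscr W[f]$ converge absolutely at every $x\in\mathbb R$, both sums belong to $L^p(\mathbb R)$, and $$\lim_{\alpha\to\infty,\ \alpha\in A}\|\mathscr I_{\phi_\alpha}[f]-\mathscr W[f]\|_{L^p(\mathbb R)}=0 .$$ -/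

import Mathlib

open MeasureTheory Filter Topology
open scoped ENNReal NNReal ContDiff

namespace CardinalInterp

noncomputable section

/-- The Fourier transform of an integrable function on the line, in the convention
`(2π)^(-1/2) ∫ g(x) e^{-ixξ} dx`. -/
def fourierT (g : ℝ → ℂ) (ξ : ℝ) : ℂ :=
  ((√(2 * Real.pi))⁻¹ : ℝ) * ∫ x : ℝ, g x * Complex.exp (-(Complex.I * x * ξ))

/-- Slowly increasing functions: locally integrable and of at most polynomial growth. -/
def SlowlyIncreasing (φ : ℝ → ℝ) : Prop :=
  LocallyIntegrable φ volume ∧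
    ∃ N : ℕ, φ =O[cocompact ℝ] fun x : ℝ => |x| ^ N

/-- Away from the origin, the distributional Fourier transform of the slowly increasing function
`φ` is the function `φhat`: one has `⟨φ, ĝ⟩ = ⟨φhat, g⟩` for every test function `g` whose
support is a compact subset of `ℝ ∖ {0}`. If `φhat` is continuous on `ℝ ∖ {0}`, this determines
it there; its value at `0` plays no role. -/
def HasFourierTransform (φ φhat : ℝ → ℝ) : Prop :=
  ∀ g : ℝ → ℂ, ContDiff ℝ ∞ g → HasCompactSupport g → (0 : ℝ) ∉ tsupport g →
    ∫ x : ℝ, (φ x : ℂ) * fourierT g x = ∫ ξ : ℝ, (φhat ξ : ℂ) * g ξ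

/-- The interpolating conditions for `φ` with Fourier transform `φhat`. -/
structure InterpolatingConditions (φ φhat : ℝ → ℝ) : Prop where
  slowly_increasing : SlowlyIncreasing φ
  fourier : HasFourierTransform φ φhat
  nonneg : ∀ ξ : ℝ, ξ ≠ 0 → 0 ≤ φhat ξ
  lower_bound : ∃ m : ℝ, 0 < m ∧ ∀ ξ ∈ Set.Icc (-Real.pi) Real.pi, ξ ≠ 0 → m ≤ φhat ξ
  contDiffOn : ContDiffOn ℝ 1 φhat {0}ᶜ
  decay : ∃ ε : ℝ, 0 < ε ∧
    (φhat =O[cocompact ℝ] fun ξ : ℝ => |ξ| ^ (-(1 + ε))) ∧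
    (deriv φhat =O[cocompact ℝ] fun ξ : ℝ => |ξ| ^ (-(1 + ε)))

/-- `u ↦ φhat (u + 2πk) / φhat u`. -/
def ratio (φhat : ℝ → ℝ) (k : ℤ) (u : ℝ) : ℝ :=
  φhat (u + 2 * Real.pi * k) / φhat u

/-- `u ↦ φhat' (u + 2πk) / φhat u`. -/
def derivRatio (φhat : ℝ → ℝ) (k : ℤ) (u : ℝ) : ℝ :=
  deriv φhat (u + 2 * Real.pi * k) / φhat u

/-- `{φ α : α ∈ A}`, with Fourier transforms `φhat α`, is a spline-like family of cardinal
interpolators. The limit `α → ∞` within `A` is the filter `atTop ⊓ 𝓟 A`. -/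
structure SplineLikeFamily (A : Set ℝ) (φ φhat : ℝ → ℝ → ℝ) : Prop where
  index_pos : A ⊆ Set.Ioi 0
  index_unbounded : ¬ BddAbove A
  interpolating : ∀ α ∈ A, InterpolatingConditions (φ α) (φhat α)
  sum_bound : ∃ C : ℝ≥0, ∀ α ∈ A,
    ∑' j : ℤ, ∑' k : {k : ℤ // k ≠ j},
      ∫⁻ u in Set.Icc (-Real.pi) Real.pi,
        ‖ratio (φhat α) j u * derivRatio (φhat α) k u‖ₑ ≤ (C : ℝ≥0∞)
  ratio_tendsto : ∀ j : ℤ, j ≠ 0 →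
    ∀ᵐ u ∂(volume.restrict (Set.Icc (-Real.pi) Real.pi)),
      Tendsto (fun α => ratio (φhat α) j u) (atTop ⊓ 𝓟 A) (𝓝 0)
  ratio_dominated : ∃ M : ℤ → ℝ, Summable M ∧
    ∀ j : ℤ, j ≠ 0 → ∀ α ∈ A, ∀ u ∈ Set.Icc (-Real.pi) Real.pi, u ≠ 0 →
      ratio (φhat α) j u ≤ M j

/-- The Fourier transform of the fundamental function. -/
def fundamentalHat (φhat : ℝ → ℝ) (ξ : ℝ) : ℝ :=
  (√(2 * Real.pi))⁻¹ * (φhat ξ / ∑' j : ℤ, φhat (ξ + 2 * Real.pi * j))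

/-- The fundamental function: the inverse Fourier transform of `fundamentalHat φhat`. -/
def fundamental (φhat : ℝ → ℝ) (x : ℝ) : ℂ :=
  ((√(2 * Real.pi))⁻¹ : ℝ) *
    ∫ ξ : ℝ, (fundamentalHat φhat ξ : ℂ) * Complex.exp (Complex.I * x * ξ)

/-- The cardinal interpolant `∑ f(j) L(x - j)` of the data `f`. -/
def interpolant (φhat : ℝ → ℝ) (f : ℤ → ℂ) (x : ℝ) : ℂ :=
  ∑' j : ℤ, f j * fundamental φhat (x - j)

/-- The Whittaker map (cardinal sinc series); `Real.sinc t` is `sin t / t`, with value `1`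
at `0`. -/
def whittaker (f : ℤ → ℂ) (x : ℝ) : ℂ :=
  ∑' k : ℤ, f k * (Real.sinc (Real.pi * (x - k)) : ℂ)

end

end CardinalInterp

namespace CardinalInterp

noncomputable section

/-! Both the interpolants and the cardinal series have the form `∑ f(j) K(x - j)`, so the claim is
strong convergence of operators from `ℓ^p` to `L^p`. Two facts suffice: the kernels `L_α` give
operators bounded uniformly in `α` (`exists_uniform_kernelBound`), and `L_α(x)` tends to the
cardinal sine pointwise (`tendsto_fundamental`) under a common majorant `const · (1 + x²)^(-1/2)`,
which lies in `L^p` for `p > 1`. The majorant gives convergence on finitely supported data, and the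
uniform bound disposes of the tail of `f` (`tendsto_eLpNorm_tsum_translates`).

For the uniform bound, the quotient rule and (B2) make the derivative of the transform of `L_α`
integrable off `2πℤ`, while (B4) controls its one-sided limits at `2πj` by a multiple of `M j`.
Integration by parts then exhibits `x L_α(x)` as the Fourier transform of a measure, partly a
density and partly atoms on `2πℤ`, whose total mass is bounded in terms of `C` and `∑ M j` alone.
Now split `L = L / (1 + x²) + (x / (1 + x²)) · (x L)`. The first term is handled by Young's
inequality. The second is the conjugate Poisson kernel times the transform of a finite measure, that
is, a superposition of modulations, and modulations do not change norms. The cardinal sine is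
treated in the same way, since `x sinc(πx) = sin(πx) / π` has two atoms.

Everything thus rests on a theorem of M. Riesz type for the kernel `x / (1 + x²)`
(`exists_kernelBound_conjBump`). For `1 < r < 3` and `f ≥ 0`, the function `F(z) = i ∑ f(j) / (z -
j)` has positive real part in the upper half-plane, so `F^r` is holomorphic there, and its integral
over `Im z = 1` vanishes by Cauchy's theorem. Integrating an inequality `|Im F|^r ≤ A (Re F)^r - B
Re F^r` bounds the conjugate sum by the Poisson sum. For `r ≥ 3` one passes to sums over integers,
where the kernel is antisymmetric, and uses duality. -/

/-! ### Weighted Hölder inequalities. -/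

/-- Hölder's inequality applied to `w g = (w^(1/r) g) · w^(1/q)`, with `q` conjugate to `r`. -/
theorem lintegral_mul_rpow_le {Ω : Type*} [MeasurableSpace Ω] (μ : Measure Ω) {r : ℝ} (hr : 1 < r)
    {w g : Ω → ℝ≥0∞} (hw : AEMeasurable w μ) (hg : AEMeasurable g μ) :
    (∫⁻ t, w t * g t ∂μ) ^ r ≤ (∫⁻ t, w t ∂μ) ^ (r - 1) * ∫⁻ t, w t * g t ^ r ∂μ := by
  have hr0 : 0 < r := by linarith
  have hc : r.HolderConjugate (Real.conjExponent r) := .conjExponent hr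
  set q := Real.conjExponent r with hq
  have hq0 : 0 < q := hc.symm.pos
  have hsum : 1 / r + 1 / q = 1 := by simpa using hc.inv_add_inv_eq_one
  have h1 : ∀ t, w t * g t = (w t ^ (1 / r) * g t) * w t ^ (1 / q) := fun t => by
    conv_lhs => rw [← ENNReal.rpow_one (w t), ← hsum,
      ENNReal.rpow_add_of_nonneg _ _ (by positivity) (by positivity)]
    ring
  have h2 := ENNReal.lintegral_mul_le_Lp_mul_Lq μ hc ((hw.pow_const (1 / r)).mul hg)
    (hw.pow_const (1 / q))
  have h3 : ∫⁻ t, w t * g t ∂μ = ∫⁻ t, ((fun t => w t ^ (1 / r) * g t) * fun t => w t ^ (1 / q)) t ∂μ :=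
    lintegral_congr fun t => by simpa using h1 t
  calc (∫⁻ t, w t * g t ∂μ) ^ r
      ≤ ((∫⁻ t, w t * g t ^ r ∂μ) ^ (1 / r) * (∫⁻ t, w t ∂μ) ^ (1 / q)) ^ r := by
        gcongr
        rw [h3]
        refine h2.trans (le_of_eq ?_)
        congr 2
        · refine lintegral_congr fun t => ?_
          simp only [Pi.mul_apply]
          rw [ENNReal.mul_rpow_of_nonneg _ _ hr0.le, ← ENNReal.rpow_mul, one_div_mul_cancel hr0.ne',
            ENNReal.rpow_one]
        · refine lintegral_congr fun t => ?_
          rw [← ENNReal.rpow_mul, one_div_mul_cancel hq0.ne', ENNReal.rpow_one]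
    _ = _ := by
        rw [ENNReal.mul_rpow_of_nonneg _ _ hr0.le, ← ENNReal.rpow_mul, ← ENNReal.rpow_mul,
          one_div_mul_cancel hr0.ne', ENNReal.rpow_one, mul_comm]
        congr 2
        have := hc.sub_one_mul_conj
        field_simp
        linarith

theorem sum_mul_rpow_le {ι : Type*} (S : Finset ι) {r : ℝ} (hr : 1 < r) (w g : ι → ℝ≥0∞) :
    (∑ i ∈ S, w i * g i) ^ r ≤ (∑ i ∈ S, w i) ^ (r - 1) * ∑ i ∈ S, w i * g i ^ r := by
  have hr0 : 0 < r := by linarith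
  refine (ENNReal.rpow_le_rpow (ENNReal.inner_le_weight_mul_Lp_of_nonneg S hr.le w g) hr0.le).trans
    (le_of_eq ?_)
  rw [ENNReal.mul_rpow_of_nonneg _ _ hr0.le, ← ENNReal.rpow_mul, ← ENNReal.rpow_mul,
    inv_mul_cancel₀ hr0.ne', ENNReal.rpow_one]
  congr 2
  field_simp

/-! ### Young's inequality for the Poisson kernel. -/

/-- The kernel `1 / (1 + x²)`. -/
def bump (x : ℝ) : ℝ := (1 + x ^ 2)⁻¹

theorem bump_pos (x : ℝ) : 0 < bump x := by unfold bump; positivity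

theorem continuous_bump : Continuous bump := by
  unfold bump
  exact Continuous.inv₀ (by fun_prop) fun x => by positivity

theorem bump_le_two_mul {a b : ℝ} (h : |a - b| ≤ 1 / 2) : bump a ≤ 2 * bump b := by
  unfold bump
  have h1 := abs_le.1 h
  -- The difference of the two sides is `1 + (2a - b)² - 2(a - b)²`, which is at least `1/2`.
  have h2 : 1 + b ^ 2 ≤ 2 * (1 + a ^ 2) := by nlinarith [sq_nonneg (2 * a - b), sq_nonneg (a - b)]
  rw [← div_eq_mul_inv, inv_eq_one_div, div_le_div_iff₀ (by positivity) (by positivity)]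
  linarith

theorem summable_bump : Summable fun n : ℤ => bump n := by
  have h : Summable fun n : ℤ => ((n : ℝ) ^ 2)⁻¹ := by
    simpa using Real.summable_one_div_int_pow.2 (le_refl 2)
  refine Summable.of_norm_bounded_eventually (g := fun n : ℤ => ((n : ℝ) ^ 2)⁻¹) h ?_
  filter_upwards [(Set.finite_singleton (0 : ℤ)).compl_mem_cofinite] with n hn
  rw [Real.norm_of_nonneg (bump_pos _).le]
  have hn' : (n : ℝ) ≠ 0 := by exact_mod_cast hn
  unfold bump
  gcongr
  linarith

/-- A bound for the sums `∑ 1 / (1 + (x - j)²)` over `j ∈ ℤ`. -/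
def bumpSum : ℝ := 2 * ∑' n : ℤ, bump n

/-- Moving `x` to the nearest integer costs the factor 2 in `bumpSum`; the full sum over `ℤ` is then
invariant under integer shifts. -/
theorem sum_bump_le (S : Finset ℤ) (x : ℝ) : ∑ j ∈ S, bump (x - j) ≤ bumpSum := by
  have h1 : ∀ j : ℤ, bump (x - j) ≤ 2 * bump ((round x - j : ℤ) : ℝ) := fun j => by
    refine bump_le_two_mul ?_
    push_cast
    have := abs_sub_round x
    rwa [show x - j - (round x - j) = x - round x by ring]
  have h2 : Summable fun j : ℤ => bump ((round x - j : ℤ) : ℝ) :=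
    (Equiv.subLeft (round x)).summable_iff.2 summable_bump
  calc ∑ j ∈ S, bump (x - j) ≤ ∑ j ∈ S, 2 * bump ((round x - j : ℤ) : ℝ) :=
        Finset.sum_le_sum fun j _ => h1 j
    _ ≤ ∑' j : ℤ, 2 * bump ((round x - j : ℤ) : ℝ) :=
        (h2.mul_left 2).sum_le_tsum _ fun j _ => (mul_pos two_pos (bump_pos _)).le
    _ = bumpSum := by
        rw [tsum_mul_left, bumpSum]
        congr 1
        exact (Equiv.subLeft (round x)).tsum_eq fun n : ℤ => bump n

theorem lintegral_bump_sub (y : ℝ) : ∫⁻ x, ENNReal.ofReal (bump (x - y)) = ENNReal.ofReal Real.pi := by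
  rw [lintegral_sub_right_eq_self (fun x => ENNReal.ofReal (bump x)) y]
  unfold bump
  rw [← ofReal_integral_eq_lintegral_ofReal integrable_inv_one_add_sq
      (ae_of_all _ fun x => (bump_pos x).le), integral_univ_inv_one_add_sq]

/-- The constant in the discrete Young inequality for the kernel `bump`. -/
def youngConst (r : ℝ) : ℝ≥0∞ := ENNReal.ofReal bumpSum ^ (r - 1) * ENNReal.ofReal Real.pi

theorem youngConst_ne_top {r : ℝ} (hr : 1 < r) : youngConst r ≠ ⊤ :=
  ENNReal.mul_ne_top (ENNReal.rpow_ne_top_of_nonneg (by linarith) ENNReal.ofReal_ne_top)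
    ENNReal.ofReal_ne_top

/-- Jensen's inequality with the weights `bump (x - j)`, whose sum over `j` is at most `bumpSum`;
each weight then integrates to `π` in `x`. -/
theorem lintegral_sum_bump_rpow_le {r : ℝ} (hr : 1 < r) (S : Finset ℤ) (g : ℤ → ℝ≥0∞) :
    ∫⁻ x : ℝ, (∑ j ∈ S, ENNReal.ofReal (bump (x - j)) * g j) ^ r
      ≤ youngConst r * ∑ j ∈ S, g j ^ r := by
  have hm : ∀ j : ℤ, Measurable fun x : ℝ => ENNReal.ofReal (bump (x - j)) := fun j =>
    ENNReal.measurable_ofReal.comp (continuous_bump.measurable.comp (measurable_id.sub_const _))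
  calc ∫⁻ x : ℝ, (∑ j ∈ S, ENNReal.ofReal (bump (x - j)) * g j) ^ r
      ≤ ∫⁻ x : ℝ, ENNReal.ofReal bumpSum ^ (r - 1) *
          ∑ j ∈ S, ENNReal.ofReal (bump (x - j)) * g j ^ r := by
        refine lintegral_mono fun x => (sum_mul_rpow_le S hr _ _).trans ?_
        refine mul_le_mul_left (ENNReal.rpow_le_rpow ?_ (by linarith)) _
        rw [← ENNReal.ofReal_sum_of_nonneg fun j _ => (bump_pos _).le]
        exact ENNReal.ofReal_le_ofReal (sum_bump_le S x)
    _ = _ := by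
        rw [lintegral_const_mul _ (Finset.measurable_sum _ fun j _ => (hm j).mul_const _),
          lintegral_finsetSum _ fun j _ => (hm j).mul_const _, youngConst, mul_assoc]
        congr 1
        rw [Finset.mul_sum]
        refine Finset.sum_congr rfl fun j _ => ?_
        rw [lintegral_mul_const _ (hm j), lintegral_bump_sub]

/-! ### Operators from sequences to functions given by a kernel. -/

/-- The operator `f ↦ ∑ f(j) K(x - j)`, on finitely supported sequences, is bounded from `ℓ^r` to
`L^r`, with the `r`-th power of its norm at most `c`. -/
def KernelBound (r : ℝ) (K : ℝ → ℂ) (c : ℝ≥0∞) : Prop :=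
  ∀ (S : Finset ℤ) (f : ℤ → ℂ),
    ∫⁻ x : ℝ, ‖∑ j ∈ S, f j * K (x - j)‖ₑ ^ r ≤ c * ∑ j ∈ S, ‖f j‖ₑ ^ r

theorem KernelBound.mono {r : ℝ} {K : ℝ → ℂ} {c d : ℝ≥0∞} (h : KernelBound r K c) (hcd : c ≤ d) :
    KernelBound r K d := fun S f => (h S f).trans (by gcongr)

theorem measurable_sum_translates {K : ℝ → ℂ} (hK : Measurable K) (S : Finset ℤ) (f : ℤ → ℂ) :
    Measurable fun x : ℝ => ∑ j ∈ S, f j * K (x - j) :=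
  Finset.measurable_sum _ fun j _ => (hK.comp (measurable_id.sub_const _)).const_mul _

theorem lintegral_enorm_add_rpow_le {Ω : Type*} [MeasurableSpace Ω] {μ : Measure Ω} {r : ℝ}
    (hr : 1 < r) {F G : Ω → ℂ} (hF : Measurable F) :
    ∫⁻ x, ‖F x + G x‖ₑ ^ r ∂μ ≤ 2 ^ (r - 1) * (∫⁻ x, ‖F x‖ₑ ^ r ∂μ + ∫⁻ x, ‖G x‖ₑ ^ r ∂μ) := by
  rw [← lintegral_add_left (by fun_prop), ← lintegral_const_mul' _ _ (by simp)]
  refine lintegral_mono fun x => ?_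
  refine (ENNReal.rpow_le_rpow (enorm_add_le _ _) (by linarith)).trans ?_
  exact ENNReal.rpow_add_le_mul_rpow_add_rpow _ _ hr.le

theorem KernelBound.add {r : ℝ} (hr : 1 < r) {K L : ℝ → ℂ} {c d : ℝ≥0∞} (hK : Measurable K)
    (h : KernelBound r K c) (h' : KernelBound r L d) :
    KernelBound r (fun x => K x + L x) (2 ^ (r - 1) * (c + d)) := fun S f => by
  simp only [mul_add, Finset.sum_add_distrib]
  refine (lintegral_enorm_add_rpow_le hr (measurable_sum_translates hK S f)).trans ?_
  rw [← mul_add, mul_assoc, add_mul]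
  gcongr
  · exact h S f
  · exact h' S f

theorem enorm_sum_translates_le {K : ℝ → ℂ} {B : ℝ} (h : ∀ x, ‖K x‖ ≤ B * bump x)
    (S : Finset ℤ) (f : ℤ → ℂ) (x : ℝ) :
    ‖∑ j ∈ S, f j * K (x - j)‖ₑ ≤
      ENNReal.ofReal B * ∑ j ∈ S, ENNReal.ofReal (bump (x - j)) * ‖f j‖ₑ := by
  refine (enorm_sum_le _ _).trans ?_
  rw [Finset.mul_sum]
  refine Finset.sum_le_sum fun j _ => ?_
  rw [enorm_mul, mul_comm, ← mul_assoc]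
  gcongr
  rw [← ofReal_norm, ← ENNReal.ofReal_mul' (bump_pos _).le]
  exact ENNReal.ofReal_le_ofReal (h _)

theorem kernelBound_of_le_bump {r : ℝ} (hr : 1 < r) {K : ℝ → ℂ} {B : ℝ}
    (h : ∀ x, ‖K x‖ ≤ B * bump x) :
    KernelBound r K (ENNReal.ofReal B ^ r * youngConst r) := fun S f => by
  calc ∫⁻ x : ℝ, ‖∑ j ∈ S, f j * K (x - j)‖ₑ ^ r
      ≤ ∫⁻ x : ℝ, ENNReal.ofReal B ^ r *
          (∑ j ∈ S, ENNReal.ofReal (bump (x - j)) * ‖f j‖ₑ) ^ r := by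
        refine lintegral_mono fun x => ?_
        rw [← ENNReal.mul_rpow_of_nonneg _ _ (by linarith)]
        exact ENNReal.rpow_le_rpow (enorm_sum_translates_le h S f x) (by linarith)
    _ ≤ _ := by
        rw [lintegral_const_mul' _ _ (ENNReal.rpow_ne_top_of_nonneg (by linarith) (by simp)),
          mul_assoc]
        gcongr
        exact lintegral_sum_bump_rpow_le hr S _

/-! ### A Riesz theorem for the conjugate Poisson kernel: exponents below 3. -/

/-- The only obstruction to bounding `|sin t|^r` by a multiple of `cos t ^ r` is at `t = ±π/2`.
There `cos (t * r)` is negative because `1 < r < 3`, and its term can absorb the left-hand side. -/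
theorem exists_abs_sin_rpow_le {r : ℝ} (h1 : 1 < r) (h3 : r < 3) :
    ∃ A B : ℝ, 0 ≤ A ∧ ∀ t : ℝ, |t| ≤ Real.pi / 2 →
      |Real.sin t| ^ r ≤ A * Real.cos t ^ r - B * Real.cos (t * r) := by
  have hpi := Real.pi_pos
  have hc : Real.cos (Real.pi / 2 * r) < 0 :=
    Real.cos_neg_of_pi_div_two_lt_of_lt (by nlinarith) (by nlinarith)
  set c := Real.cos (Real.pi / 2 * r) with hcdef
  -- This makes `g (±π/2) = 1 + B c = -1`, so the set where `g ≥ 0` is a compact set on which the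
  -- cosine is positive, and `A` is obtained there as a bound for `g / cos^r`.
  set B := -2 / c with hB
  have hBc : B * c = -2 := div_mul_cancel₀ _ hc.ne
  set g : ℝ → ℝ := fun t => |Real.sin t| ^ r + B * Real.cos (t * r) with hg
  have hgc : Continuous g := by
    refine Continuous.add ?_ (by fun_prop)
    exact Continuous.rpow_const (by fun_prop) fun _ => Or.inr (by linarith)
  set K : Set ℝ := Set.Icc (-(Real.pi / 2)) (Real.pi / 2) ∩ g ⁻¹' Set.Ici 0 with hK
  have hKc : IsCompact K := isCompact_Icc.inter_right (isClosed_Ici.preimage hgc)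
  have hcos : ∀ t ∈ K, 0 < Real.cos t := by
    rintro t ⟨⟨ht1, ht2⟩, ht3⟩
    simp only [hg, Set.mem_preimage, Set.mem_Ici] at ht3
    refine Real.cos_pos_of_mem_Ioo ⟨lt_of_le_of_ne ht1 ?_, lt_of_le_of_ne ht2 ?_⟩
    · rintro rfl
      rw [neg_mul, Real.cos_neg, ← hcdef, hBc] at ht3
      norm_num at ht3
    · rintro rfl
      rw [← hcdef, hBc] at ht3
      norm_num at ht3
  obtain ⟨A, hA⟩ := hKc.exists_bound_of_continuousOn (f := fun t => g t / Real.cos t ^ r)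
    (hgc.continuousOn.div (Continuous.continuousOn <|
      Continuous.rpow_const (by fun_prop) fun _ => Or.inr (by linarith))
      fun t ht => (Real.rpow_pos_of_pos (hcos t ht) r).ne')
  refine ⟨max A 0, B, le_max_right _ _, fun t ht => ?_⟩
  have ht' := abs_le.1 ht
  have hct : 0 ≤ Real.cos t ^ r :=
    Real.rpow_nonneg (Real.cos_nonneg_of_neg_pi_div_two_le_of_le (by linarith) ht'.2) _
  rw [le_sub_iff_add_le]
  by_cases hgt : 0 ≤ g t
  · have hKt : t ∈ K := ⟨ht', hgt⟩
    have h2 := (le_abs_self _).trans (hA t hKt)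
    rw [div_le_iff₀ (Real.rpow_pos_of_pos (hcos t hKt) r)] at h2
    exact h2.trans (mul_le_mul_of_nonneg_right (le_max_left _ _) hct)
  · exact (not_le.1 hgt).le.trans (mul_nonneg (le_max_right _ _) hct)

/-- The trigonometric inequality at `t = arg z`, scaled by `‖z‖ ^ r`; the half-plane `Re z ≥ 0` is
exactly `|arg z| ≤ π/2`. -/
theorem exists_abs_im_rpow_le {r : ℝ} (h1 : 1 < r) (h3 : r < 3) :
    ∃ A B : ℝ, 0 ≤ A ∧ ∀ z : ℂ, 0 ≤ z.re →
      |z.im| ^ r ≤ A * z.re ^ r - B * (z ^ (r : ℂ)).re := by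
  obtain ⟨A, B, hA, h⟩ := exists_abs_sin_rpow_le h1 h3
  refine ⟨A, B, hA, fun z hz => ?_⟩
  have ht : |z.arg| ≤ Real.pi / 2 := Complex.abs_arg_le_pi_div_two_iff.2 hz
  have hcos : 0 ≤ Real.cos z.arg :=
    Real.cos_nonneg_of_neg_pi_div_two_le_of_le (by linarith [(abs_le.1 ht).1]) (abs_le.1 ht).2
  rw [Complex.cpow_ofReal_re]
  nth_rewrite 1 [← Complex.norm_mul_sin_arg z]
  nth_rewrite 1 [← Complex.norm_mul_cos_arg z]
  rw [abs_mul, abs_norm, Real.mul_rpow (norm_nonneg _) (abs_nonneg _),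
    Real.mul_rpow (norm_nonneg _) hcos]
  have := mul_le_mul_of_nonneg_left (h z.arg ht) (Real.rpow_nonneg (norm_nonneg z) r)
  linarith

/-- The Cauchy transform `i ∑ f(j) / (z - j)` of a finitely supported sequence. -/
def cauchySum (S : Finset ℤ) (f : ℤ → ℝ) (z : ℂ) : ℂ :=
  ∑ j ∈ S, (f j : ℂ) * (Complex.I / (z - j))

/-- The kernel `x / (1 + x²)`. -/
def conjBump (x : ℝ) : ℝ := x * bump x

/-- On the line `Im z = 1` the Cauchy kernel splits into the Poisson kernel and the conjugate
Poisson kernel, which makes the conjugate sum the imaginary part of a holomorphic function. -/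
theorem I_div_add_I (x : ℝ) : Complex.I / (x + Complex.I) = bump x + conjBump x * Complex.I := by
  have h : ((1 + x ^ 2 : ℝ) : ℂ) ≠ 0 := by
    exact_mod_cast (by positivity : (1 + x ^ 2 : ℝ) ≠ 0)
  have h2 : (x : ℂ) + Complex.I ≠ 0 := fun h => by simpa using congrArg Complex.im h
  unfold conjBump bump
  push_cast at h ⊢
  field_simp
  linear_combination (-(x : ℂ)) * Complex.I_sq

theorem cauchySum_add_I (S : Finset ℤ) (f : ℤ → ℝ) (x : ℝ) :
    cauchySum S f (x + Complex.I) =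
      ((∑ j ∈ S, f j * bump (x - j) : ℝ) : ℂ) + ((∑ j ∈ S, f j * conjBump (x - j) : ℝ) : ℂ) * Complex.I := by
  unfold cauchySum
  push_cast
  rw [Finset.sum_mul, ← Finset.sum_add_distrib]
  refine Finset.sum_congr rfl fun j _ => ?_
  have := I_div_add_I (x - j)
  push_cast at this
  rw [show (x : ℂ) + Complex.I - j = x - j + Complex.I by ring, this]
  ring

/-- `Re (i / (z - j)) = Im z / |z - j|²`. Positivity keeps the values off the branch cut of the
power `z ^ r`. -/
theorem cauchySum_re_pos {S : Finset ℤ} {f : ℤ → ℝ} (hf : ∀ j, 0 ≤ f j) (hS : ∃ j ∈ S, 0 < f j)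
    {z : ℂ} (hz : 0 < z.im) : 0 < (cauchySum S f z).re := by
  have key : ∀ j : ℤ, 0 < (Complex.I / (z - j)).re := fun j => by
    have hne : z - j ≠ 0 := fun h => by
      have := congrArg Complex.im h
      simp at this
      linarith
    rw [Complex.div_re]
    simp only [Complex.I_re, zero_mul, zero_div, Complex.I_im, one_mul, zero_add, Complex.sub_im,
      Complex.intCast_im, sub_zero]
    exact div_pos hz (Complex.normSq_pos.2 hne)
  unfold cauchySum
  rw [Complex.re_sum]
  simp only [Complex.re_ofReal_mul]
  obtain ⟨j, hj, hfj⟩ := hS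
  exact Finset.sum_pos' (fun i _ => mul_nonneg (hf i) (key i).le) ⟨j, hj, mul_pos hfj (key j)⟩

theorem norm_cauchySum_le (S : Finset ℤ) {f : ℤ → ℝ} (hf : ∀ j, 0 ≤ f j) :
    ∃ M : ℝ, 0 ≤ M ∧ ∀ z : ℂ, 1 ≤ z.im → ‖cauchySum S f z‖ ≤ M / ‖z‖ := by
  refine ⟨∑ j ∈ S, f j * (1 + |(j : ℝ)|),
    Finset.sum_nonneg fun j _ => mul_nonneg (hf j) (by positivity), fun z hz => ?_⟩
  unfold cauchySum
  refine (norm_sum_le _ _).trans ?_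
  rw [Finset.sum_div]
  refine Finset.sum_le_sum fun j _ => ?_
  have h1 : 1 ≤ ‖z - j‖ := by
    have := Complex.abs_im_le_norm (z - j)
    simp only [Complex.sub_im, Complex.intCast_im, sub_zero] at this
    exact hz.trans ((le_abs_self _).trans this)
  -- Since `‖z - j‖ ≥ 1`, this yields `‖z‖ ≤ (1 + |j|) ‖z - j‖`, whence the constant.
  have h2 : ‖z‖ ≤ ‖z - j‖ + |(j : ℝ)| := by
    have := norm_add_le (z - j) (j : ℂ)
    simpa using this
  have h3 : 1 ≤ ‖z‖ := hz.trans ((le_abs_self _).trans (Complex.abs_im_le_norm z))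
  rw [norm_mul, norm_div, Complex.norm_I, Complex.norm_real, Real.norm_of_nonneg (hf j), mul_div_assoc]
  refine mul_le_mul_of_nonneg_left ?_ (hf j)
  rw [div_le_div_iff₀ (by linarith) (by linarith)]
  nlinarith [abs_nonneg (j : ℝ)]

theorem differentiableAt_cauchySum_cpow {S : Finset ℤ} {f : ℤ → ℝ} (hf : ∀ j, 0 ≤ f j)
    (hS : ∃ j ∈ S, 0 < f j) (r : ℝ) {z : ℂ} (hz : 0 < z.im) :
    DifferentiableAt ℂ (fun z => cauchySum S f z ^ (r : ℂ)) z := by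
  refine DifferentiableAt.cpow_const ?_ (Or.inl (cauchySum_re_pos hf hS hz))
  unfold cauchySum
  refine DifferentiableAt.fun_sum fun j _ => ?_
  refine (DifferentiableAt.div (by fun_prop) (by fun_prop) fun h => ?_).const_mul _
  have := congrArg Complex.im h
  simp at this
  linarith

theorem integrable_rpow_bump {r : ℝ} (h1 : 1 < r) : Integrable fun x : ℝ => bump x ^ (r / 2) := by
  have := integrable_rpow_neg_one_add_norm_sq (E := ℝ) (μ := volume) (r := r) (by simpa using h1)
  refine this.congr (ae_of_all _ fun x => ?_)
  simp only [bump, Real.norm_eq_abs, sq_abs]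
  rw [Real.inv_rpow (by positivity), ← Real.rpow_neg (by positivity), neg_div]

theorem norm_rpow_neg_eq (x : ℝ) (r : ℝ) : (1 / ‖(x : ℂ) + Complex.I‖) ^ r = bump x ^ (r / 2) := by
  have h : ‖(x : ℂ) + Complex.I‖ = (1 + x ^ 2) ^ (1 / 2 : ℝ) := by
    rw [← Real.sqrt_eq_rpow, Complex.norm_def, Complex.normSq_apply]
    congr 1
    simp
    ring
  rw [h, bump, one_div, ← Real.rpow_neg (by positivity), ← Real.rpow_mul (by positivity),
    Real.inv_rpow (by positivity), ← Real.rpow_neg (by positivity)]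
  congr 1
  ring

theorem integrable_cauchySum_cpow {S : Finset ℤ} {f : ℤ → ℝ} (hf : ∀ j, 0 ≤ f j)
    (hS : ∃ j ∈ S, 0 < f j) {r : ℝ} (h1 : 1 < r) :
    Integrable fun x : ℝ => cauchySum S f (x + Complex.I) ^ (r : ℂ) := by
  obtain ⟨M, hM, h⟩ := norm_cauchySum_le S hf
  refine ((integrable_rpow_bump h1).const_mul (M ^ r)).mono' ?_ (ae_of_all _ fun x => ?_)
  · refine Continuous.aestronglyMeasurable (continuous_iff_continuousAt.2 fun x => ?_)
    exact ContinuousAt.comp (f := fun x : ℝ => (x : ℂ) + Complex.I)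
      (differentiableAt_cauchySum_cpow hf hS r (z := x + Complex.I) (by simp)).continuousAt
      (by fun_prop)
  · rw [Complex.norm_cpow_real, ← norm_rpow_neg_eq, ← Real.mul_rpow hM (by positivity),
      mul_one_div]
    exact Real.rpow_le_rpow (norm_nonneg _) (h _ (by simp)) (by linarith)

/-- Cauchy's theorem on the rectangle `[-R, R] × [1, 1 + R]`. On the three sides other than the
bottom one the integrand is at most `M^r R^(-r)` and their total length is `4R`, so their
contribution is `O(R^(1 - r))`. -/
theorem integral_cauchySum_cpow {S : Finset ℤ} {f : ℤ → ℝ} (hf : ∀ j, 0 ≤ f j)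
    (hS : ∃ j ∈ S, 0 < f j) {r : ℝ} (h1 : 1 < r) :
    ∫ x : ℝ, cauchySum S f (x + Complex.I) ^ (r : ℂ) = 0 := by
  obtain ⟨M, hM, h⟩ := norm_cauchySum_le S hf
  set Q : ℂ → ℂ := fun z => cauchySum S f z ^ (r : ℂ) with hQ
  have hbd : ∀ R : ℝ, 0 < R → ∀ z : ℂ, 1 ≤ z.im → R ≤ ‖z‖ → ‖Q z‖ ≤ M ^ r * R ^ (-r) := by
    intro R hR z hz hRz
    rw [hQ, Complex.norm_cpow_real, Real.rpow_neg hR.le, ← div_eq_mul_inv,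
      ← Real.div_rpow hM hR.le]
    exact Real.rpow_le_rpow (norm_nonneg _) ((h z hz).trans (by gcongr)) (by linarith)
  have hlim : Tendsto (fun R : ℝ => 4 * (M ^ r * R ^ (1 - r))) atTop (𝓝 0) := by
    have := (tendsto_rpow_neg_atTop (y := r - 1) (by linarith)).const_mul (4 * M ^ r)
    rw [mul_zero] at this
    refine this.congr fun R => ?_
    rw [neg_sub, mul_assoc]
  have hrect : ∀ R : ℝ, 0 < R → ‖∫ x : ℝ in (-R)..R, Q (x + Complex.I)‖ ≤ 4 * (M ^ r * R ^ (1 - r)) := by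
    intro R hR
    have hrec := Complex.integral_boundary_rect_eq_zero_of_differentiableOn Q
      (-R + Complex.I) (R + ((1 + R : ℝ) : ℂ) * Complex.I) (by
        intro z hz
        refine (differentiableAt_cauchySum_cpow hf hS r ?_).differentiableWithinAt
        rw [Complex.mem_reProdIm] at hz
        have := hz.2
        simp only [Complex.add_im, Complex.neg_im, Complex.ofReal_im, neg_zero, Complex.I_im, zero_add,
          Complex.mul_im, Complex.ofReal_re, mul_one, Complex.I_re, mul_zero, add_zero] at this
        rw [Set.uIcc_of_le (by linarith)] at this
        linarith [this.1])
    simp only [Complex.add_im, Complex.neg_im, Complex.ofReal_im, neg_zero, Complex.I_im, zero_add,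
      Complex.mul_im, Complex.ofReal_re, mul_one, Complex.I_re, mul_zero, add_zero, Complex.add_re,
      Complex.neg_re, Complex.mul_re, Complex.ofReal_one, one_mul, sub_self] at hrec
    have e1 : ‖∫ x : ℝ in (-R)..R, Q (x + ((1 + R : ℝ) : ℂ) * Complex.I)‖ ≤
        M ^ r * R ^ (-r) * |R - (-R)| :=
      intervalIntegral.norm_integral_le_of_norm_le_const fun x _ => hbd R hR _ (by simp; linarith) (by
        refine le_trans ?_ (Complex.abs_im_le_norm _)
        simp only [Complex.add_im, Complex.ofReal_im, Complex.mul_im, Complex.ofReal_re, Complex.I_im,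
          mul_one, Complex.I_re, mul_zero, add_zero, zero_add]
        exact le_trans (by linarith) (le_abs_self _))
    have e2 : ∀ a : ℝ, |a| = R → ‖∫ y : ℝ in (1 : ℝ)..(1 + R), Q (a + y * Complex.I)‖ ≤
        M ^ r * R ^ (-r) * |1 + R - 1| := fun a ha =>
      intervalIntegral.norm_integral_le_of_norm_le_const fun y hy => hbd R hR _ (by
        rw [Set.uIoc_of_le (by linarith)] at hy
        simpa using hy.1.le) (by
        refine le_trans ?_ (Complex.abs_re_le_norm _)
        simp [ha])
    have e3 := e2 R (abs_of_pos hR)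
    have e4 := e2 (-R) (by rw [abs_neg, abs_of_pos hR])
    have hpow : R ^ (-r) * R = R ^ (1 - r) := by
      rw [show (1 - r) = -r + 1 by ring, Real.rpow_add hR, Real.rpow_one]
    rw [show R - -R = 2 * R by ring, abs_of_pos (by linarith)] at e1
    rw [show 1 + R - 1 = R by ring, abs_of_pos hR] at e3 e4
    push_cast at e1 e4 hrec
    set a1 := ∫ x : ℝ in (-R)..R, Q (x + Complex.I)
    set a2 := ∫ x : ℝ in (-R)..R, Q (x + (1 + R) * Complex.I)
    set a3 := ∫ y : ℝ in (1 : ℝ)..(1 + R), Q (R + y * Complex.I)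
    set a4 := ∫ y : ℝ in (1 : ℝ)..(1 + R), Q (-R + y * Complex.I)
    have : a1 = a2 - Complex.I • a3 + Complex.I • a4 := by linear_combination hrec
    rw [this]
    calc _ ≤ ‖a2‖ + ‖Complex.I • a3‖ + ‖Complex.I • a4‖ :=
          (norm_add_le _ _).trans (by gcongr; exact norm_sub_le _ _)
      _ ≤ _ := by
          simp only [norm_smul, Complex.norm_I, one_mul]
          rw [← hpow]
          linarith
  have ht := intervalIntegral_tendsto_integral (integrable_cauchySum_cpow hf hS h1)
    tendsto_neg_atTop_atBot tendsto_id
  refine tendsto_nhds_unique ht ?_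
  rw [tendsto_zero_iff_norm_tendsto_zero]
  refine squeeze_zero' (.of_forall fun _ => norm_nonneg _) ?_ hlim
  filter_upwards [eventually_gt_atTop 0] with R hR using hrect R hR

theorem lintegral_sum_conjBump_rpow_le {r : ℝ} (h1 : 1 < r) {A B : ℝ} (hA : 0 ≤ A)
    (hAB : ∀ z : ℂ, 0 ≤ z.re → |z.im| ^ r ≤ A * z.re ^ r - B * (z ^ (r : ℂ)).re)
    (S : Finset ℤ) {f : ℤ → ℝ} (hf : ∀ j, 0 ≤ f j) :
    ∫⁻ x : ℝ, ‖∑ j ∈ S, (f j : ℂ) * (conjBump (x - j) : ℂ)‖ₑ ^ r ≤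
      ENNReal.ofReal A * youngConst r * ∑ j ∈ S, ‖(f j : ℂ)‖ₑ ^ r := by
  have hr0 : 0 < r := by linarith
  -- The zero sequence is set apart: strict positivity of the real part needs a nonzero term.
  by_cases hS : ∃ j ∈ S, 0 < f j
  swap
  · push Not at hS
    have h0 : ∀ j ∈ S, f j = 0 := fun j hj => le_antisymm (hS j hj) (hf j)
    have : ∀ x : ℝ, ∑ j ∈ S, (f j : ℂ) * (conjBump (x - j) : ℂ) = 0 := fun x =>
      Finset.sum_eq_zero fun j hj => by simp [h0 j hj]
    simp [this, hr0]
  set F : ℝ → ℂ := fun x => cauchySum S f (x + Complex.I) with hF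
  have hre : ∀ x, (F x).re = ∑ j ∈ S, f j * bump (x - j) := fun x => by
    simp only [hF, cauchySum_add_I]
    simp
  have him : ∀ x, (F x).im = ∑ j ∈ S, f j * conjBump (x - j) := fun x => by
    simp only [hF, cauchySum_add_I]
    simp
  have hpos : ∀ x, 0 ≤ (F x).re := fun x => (cauchySum_re_pos hf hS (by simp)).le
  have hcont : Continuous F := by
    have : F = fun x => ((∑ j ∈ S, f j * bump (x - j) : ℝ) : ℂ) +
        ((∑ j ∈ S, f j * conjBump (x - j) : ℝ) : ℂ) * Complex.I :=
      funext fun x => cauchySum_add_I S f x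
    rw [this]
    unfold conjBump
    have := continuous_bump
    fun_prop
  have hint := integrable_cauchySum_cpow hf hS h1
  have hnorm : ∀ x : ℝ, ‖cauchySum S f (x + Complex.I) ^ (r : ℂ)‖ = ‖F x‖ ^ r := fun x =>
    Complex.norm_cpow_real _ _
  have hV : Integrable fun x => |(F x).im| ^ r := by
    refine hint.mono (Continuous.aestronglyMeasurable ?_) (ae_of_all _ fun x => ?_)
    · exact Continuous.rpow_const (by fun_prop) fun _ => Or.inr hr0.le
    · rw [Real.norm_of_nonneg (by positivity), hnorm]
      exact Real.rpow_le_rpow (abs_nonneg _) (Complex.abs_im_le_norm _) hr0.le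
  have hU : Integrable fun x => (F x).re ^ r := by
    refine hint.mono (Continuous.aestronglyMeasurable ?_) (ae_of_all _ fun x => ?_)
    · exact Continuous.rpow_const (by fun_prop) fun _ => Or.inr hr0.le
    · rw [Real.norm_of_nonneg (Real.rpow_nonneg (hpos x) _), hnorm]
      exact Real.rpow_le_rpow (hpos x) ((le_abs_self _).trans (Complex.abs_re_le_norm _)) hr0.le
  have hQ : ∫ x : ℝ, (cauchySum S f (x + Complex.I) ^ (r : ℂ)).re = 0 := by
    have := integral_re hint
    simp only [RCLike.re_to_complex] at this
    rw [this, integral_cauchySum_cpow hf hS h1, Complex.zero_re]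
  have hR : Integrable fun x : ℝ => (cauchySum S f (x + Complex.I) ^ (r : ℂ)).re := hint.re
  -- The sign of `B` is irrelevant, because the integral it multiplies is zero.
  have hle : ∫ x, |(F x).im| ^ r ≤ A * ∫ x, (F x).re ^ r := by
    calc ∫ x, |(F x).im| ^ r
        ≤ ∫ x, (A * (F x).re ^ r - B * (cauchySum S f (x + Complex.I) ^ (r : ℂ)).re) :=
          integral_mono hV ((hU.const_mul A).sub (hR.const_mul B)) fun x => hAB (F x) (hpos x)
      _ = A * ∫ x, (F x).re ^ r := by
          rw [integral_sub (hU.const_mul A) (hR.const_mul B), integral_const_mul,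
            integral_const_mul, hQ, mul_zero, sub_zero]
  calc ∫⁻ x : ℝ, ‖∑ j ∈ S, (f j : ℂ) * (conjBump (x - j) : ℂ)‖ₑ ^ r
      = ∫⁻ x, ENNReal.ofReal (|(F x).im| ^ r) := by
        refine lintegral_congr fun x => ?_
        rw [← ENNReal.ofReal_rpow_of_nonneg (abs_nonneg _) hr0.le, him, ← Real.norm_eq_abs,
          ← Complex.norm_real, ofReal_norm]
        push_cast
        rfl
    _ = ENNReal.ofReal (∫ x, |(F x).im| ^ r) :=
        (ofReal_integral_eq_lintegral_ofReal hV (ae_of_all _ fun x => by positivity)).symm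
    _ ≤ ENNReal.ofReal A * ENNReal.ofReal (∫ x, (F x).re ^ r) := by
        rw [← ENNReal.ofReal_mul hA]
        exact ENNReal.ofReal_le_ofReal hle
    _ = ENNReal.ofReal A * ∫⁻ x : ℝ, (∑ j ∈ S, ENNReal.ofReal (bump (x - j)) * ‖(f j : ℂ)‖ₑ) ^ r := by
        rw [ofReal_integral_eq_lintegral_ofReal hU (ae_of_all _ fun x => Real.rpow_nonneg (hpos x) _)]
        congr 1
        refine lintegral_congr fun x => ?_
        rw [← ENNReal.ofReal_rpow_of_nonneg (hpos x) hr0.le, hre,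
          ENNReal.ofReal_sum_of_nonneg fun j _ => mul_nonneg (hf j) (bump_pos _).le]
        congr 1
        refine Finset.sum_congr rfl fun j _ => ?_
        rw [ENNReal.ofReal_mul (hf j), mul_comm, ← ofReal_norm, Complex.norm_real,
          Real.norm_of_nonneg (hf j)]
    _ ≤ _ := by
        rw [mul_assoc]
        gcongr
        exact lintegral_sum_bump_rpow_le h1 S _

theorem continuous_conjBump : Continuous conjBump := continuous_id.mul continuous_bump

theorem measurable_ofReal_conjBump : Measurable fun x => (conjBump x : ℂ) :=
  (Complex.continuous_ofReal.comp continuous_conjBump).measurable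

/-- The bound in `KernelBound`, for a single sequence. -/
def SeqBound (r : ℝ) (K : ℝ → ℂ) (c : ℝ≥0∞) (S : Finset ℤ) (f : ℤ → ℂ) : Prop :=
  ∫⁻ x : ℝ, ‖∑ j ∈ S, f j * K (x - j)‖ₑ ^ r ≤ c * ∑ j ∈ S, ‖f j‖ₑ ^ r

theorem SeqBound.add {r : ℝ} (hr : 1 < r) {K : ℝ → ℂ} (hK : Measurable K) {c : ℝ≥0∞}
    {S : Finset ℤ} {f g h : ℤ → ℂ} (hf : SeqBound r K c S f) (hg : SeqBound r K c S g)
    (hfh : ∀ j, ‖f j‖ ≤ ‖h j‖) (hgh : ∀ j, ‖g j‖ ≤ ‖h j‖) (hadd : ∀ j, h j = f j + g j) :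
    SeqBound r K (2 ^ (r - 1) * (c + c)) S h := by
  unfold SeqBound at *
  simp only [hadd, add_mul, Finset.sum_add_distrib]
  refine (lintegral_enorm_add_rpow_le hr (measurable_sum_translates hK S f)).trans ?_
  rw [mul_assoc, add_mul]
  have key : ∀ u : ℤ → ℂ, (∀ j, ‖u j‖ ≤ ‖h j‖) →
      c * ∑ j ∈ S, ‖u j‖ₑ ^ r ≤ c * ∑ j ∈ S, ‖f j + g j‖ₑ ^ r := fun u hu => by
    gcongr with j
    rw [← hadd]
    exact enorm_le_iff_norm_le.2 (hu j)
  gcongr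
  · exact hf.trans (key f hfh)
  · exact hg.trans (key g hgh)

theorem SeqBound.const_mul {r : ℝ} {K : ℝ → ℂ} {c : ℝ≥0∞} {S : Finset ℤ} {f : ℤ → ℂ}
    (hf : SeqBound r K c S f) {a : ℂ} (ha : ‖a‖ = 1) : SeqBound r K c S fun j => a * f j := by
  have ha' : ‖a‖ₑ = 1 := by rw [← ofReal_norm, ha, ENNReal.ofReal_one]
  unfold SeqBound at *
  simp only [mul_assoc, ← Finset.mul_sum, enorm_mul, ha', one_mul]
  exact hf

/-- The holomorphic argument covers nonnegative sequences. Positive and negative parts, then real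
and imaginary parts, are dominated termwise by the original sequence, so each splitting costs only a
constant. -/
theorem exists_kernelBound_conjBump_of_lt_three {r : ℝ} (h1 : 1 < r) (h3 : r < 3) :
    ∃ c : ℝ≥0∞, c ≠ ⊤ ∧ KernelBound r (fun x => (conjBump x : ℂ)) c := by
  obtain ⟨A, B, hA, hAB⟩ := exists_abs_im_rpow_le h1 h3
  set c := ENNReal.ofReal A * youngConst r with hc
  have hctop : c ≠ ⊤ := ENNReal.mul_ne_top ENNReal.ofReal_ne_top (youngConst_ne_top h1)
  set d := 2 ^ (r - 1) * (c + c) with hd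
  have h2 : (2 : ℝ≥0∞) ^ (r - 1) ≠ ⊤ := ENNReal.rpow_ne_top_of_nonneg (by linarith) (by simp)
  have hdtop : d ≠ ⊤ := ENNReal.mul_ne_top h2 (by simp [hctop])
  have hreal : ∀ (S : Finset ℤ) (g : ℤ → ℝ),
      SeqBound r (fun x => (conjBump x : ℂ)) d S fun j => (g j : ℂ) := fun S g => by
    have hp : SeqBound r (fun x => (conjBump x : ℂ)) c S fun j => ((max (g j) 0 : ℝ) : ℂ) :=
      lintegral_sum_conjBump_rpow_le h1 hA hAB S fun j => le_max_right _ _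
    have hn : SeqBound r (fun x => (conjBump x : ℂ)) c S fun j => ((max (-g j) 0 : ℝ) : ℂ) :=
      lintegral_sum_conjBump_rpow_le h1 hA hAB S fun j => le_max_right _ _
    refine hp.add h1 measurable_ofReal_conjBump (hn.const_mul (a := -1) (by simp)) (fun j => ?_)
      (fun j => ?_) fun j => ?_
    · rw [Complex.norm_real, Complex.norm_real, Real.norm_of_nonneg (le_max_right _ _)]
      exact max_le (le_abs_self _) (abs_nonneg _)
    · rw [neg_one_mul, norm_neg, Complex.norm_real, Complex.norm_real,
        Real.norm_of_nonneg (le_max_right _ _)]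
      exact max_le (neg_le_abs _) (abs_nonneg _)
    · rw [neg_one_mul, ← sub_eq_add_neg, ← Complex.ofReal_sub]
      congr 1
      rcases le_total 0 (g j) with h | h
      · rw [max_eq_left h, max_eq_right (by linarith), sub_zero]
      · rw [max_eq_right h, max_eq_left (by linarith)]
        ring
  refine ⟨2 ^ (r - 1) * (d + d), ENNReal.mul_ne_top h2 (by simp [hdtop]), fun S f => ?_⟩
  refine (hreal S fun j => (f j).re).add h1 measurable_ofReal_conjBump
    ((hreal S fun j => (f j).im).const_mul (a := Complex.I) (by simp)) (fun j => ?_)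
    (fun j => ?_) fun j => ?_
  · simpa using Complex.abs_re_le_norm (f j)
  · simpa using Complex.abs_im_le_norm (f j)
  · rw [mul_comm]
    exact (Complex.re_add_im (f j)).symm

/-! ### Discretization and duality: exponents at least 3. -/

/-- The difference is `(a - b)(1 - ab) bump a bump b`, and `|1 - ab|` is at most the mean of `1 +
a²` and `1 + b²`. This gives at most `(bump a + bump b) / 4`, hence at most `(3/4) bump a`. Sampling
at integers therefore changes the conjugate sum by no more than a Poisson sum. -/
theorem abs_conjBump_sub_le {a b : ℝ} (h : |a - b| ≤ 1 / 2) :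
    |conjBump a - conjBump b| ≤ bump a := by
  have h1 : bump b ≤ 2 * bump a := bump_le_two_mul (by rwa [abs_sub_comm])
  have h2 : conjBump a - conjBump b = (a - b) * ((1 - a * b) * (bump a * bump b)) := by
    unfold conjBump bump
    field_simp
    ring
  have h3 : |(1 - a * b) * (bump a * bump b)| ≤ (bump a + bump b) / 2 := by
    rw [abs_mul, abs_of_pos (mul_pos (bump_pos a) (bump_pos b))]
    have h4 : bump a + bump b = ((1 + a ^ 2) + (1 + b ^ 2)) * (bump a * bump b) := by
      unfold bump
      field_simp
      ring
    rw [h4, mul_div_right_comm]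
    gcongr
    · exact (mul_pos (bump_pos a) (bump_pos b)).le
    · exact abs_le.2 ⟨by nlinarith [sq_nonneg (a - b)], by nlinarith [sq_nonneg (a + b)]⟩
  rw [h2, abs_mul]
  have := mul_le_mul h h3 (abs_nonneg _) (by norm_num)
  linarith [bump_pos a]

theorem lintegral_eq_tsum_Ioc (G : ℝ → ℝ≥0∞) :
    ∫⁻ x, G x = ∑' n : ℤ, ∫⁻ x in Set.Ioc (-(1 / 2) + (n : ℝ)) (-(1 / 2) + n + 1), G x := by
  rw [← lintegral_iUnion (fun n => measurableSet_Ioc) (Set.pairwise_disjoint_Ioc_add_intCast _),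
    iUnion_Ioc_add_intCast, setLIntegral_univ]

theorem lintegral_Ioc_const (n : ℤ) (a : ℝ≥0∞) :
    ∫⁻ _ in Set.Ioc (-(1 / 2) + (n : ℝ)) (-(1 / 2) + n + 1), a = a := by
  rw [setLIntegral_const, Real.volume_Ioc]
  ring_nf
  simp

theorem enorm_sum_conjBump_sub_le (S : Finset ℤ) (f : ℤ → ℂ) {x y : ℝ} (h : |x - y| ≤ 1 / 2) :
    ‖∑ j ∈ S, f j * (conjBump (x - j) : ℂ) - ∑ j ∈ S, f j * (conjBump (y - j) : ℂ)‖ₑ ≤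
      ∑ j ∈ S, ENNReal.ofReal (bump (x - j)) * ‖f j‖ₑ := by
  rw [← Finset.sum_sub_distrib]
  refine (enorm_sum_le _ _).trans (Finset.sum_le_sum fun j _ => ?_)
  rw [← mul_sub, enorm_mul, mul_comm]
  gcongr
  rw [← ofReal_norm, ← Complex.ofReal_sub, Complex.norm_real]
  exact ENNReal.ofReal_le_ofReal (abs_conjBump_sub_le (by
    rwa [show x - j - (y - j) = x - y by ring]))

theorem abs_sub_le_of_mem_Ioc {n : ℤ} {x : ℝ}
    (hx : x ∈ Set.Ioc (-(1 / 2) + (n : ℝ)) (-(1 / 2) + n + 1)) : |x - n| ≤ 1 / 2 :=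
  abs_le.2 ⟨by linarith [hx.1], by linarith [hx.2]⟩

/-- The discrete analogue of `KernelBound` for the kernel `conjBump`. -/
def DiscreteBound (r : ℝ) (c : ℝ≥0∞) : Prop :=
  ∀ (T S : Finset ℤ) (f : ℤ → ℂ),
    ∑ n ∈ T, ‖∑ j ∈ S, f j * (conjBump (n - j) : ℂ)‖ₑ ^ r ≤ c * ∑ j ∈ S, ‖f j‖ₑ ^ r

/-- On the unit cell around `n`, the value at `n` differs from the value at `x` by at most the
Poisson sum at `x`. Integrating over the cells and using Young's inequality compares the discrete
and continuous norms; the converse passage below is symmetric. -/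
theorem KernelBound.discreteBound {r : ℝ} (h1 : 1 < r) {c : ℝ≥0∞}
    (h : KernelBound r (fun x => (conjBump x : ℂ)) c) :
    DiscreteBound r (2 ^ (r - 1) * (c + youngConst r)) := fun T S f => by
  set V : ℝ → ℂ := fun x => ∑ j ∈ S, f j * (conjBump (x - j) : ℂ) with hV
  set E : ℝ → ℝ≥0∞ := fun x => ∑ j ∈ S, ENNReal.ofReal (bump (x - j)) * ‖f j‖ₑ with hE
  have hVm : Measurable V := measurable_sum_translates measurable_ofReal_conjBump S f
  have h2 : (2 : ℝ≥0∞) ^ (r - 1) ≠ ⊤ := ENNReal.rpow_ne_top_of_nonneg (by linarith) (by simp)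
  have hpt : ∀ n : ℤ, ∀ x ∈ Set.Ioc (-(1 / 2) + (n : ℝ)) (-(1 / 2) + n + 1),
      ‖V n‖ₑ ^ r ≤ 2 ^ (r - 1) * (‖V x‖ₑ ^ r + E x ^ r) := fun n x hx => by
    have hd := enorm_sum_conjBump_sub_le S f (abs_sub_le_of_mem_Ioc hx)
    refine le_trans (ENNReal.rpow_le_rpow ?_ (by linarith))
      (ENNReal.rpow_add_le_mul_rpow_add_rpow _ _ h1.le)
    calc ‖V n‖ₑ = ‖V x - (V x - V n)‖ₑ := by rw [sub_sub_cancel]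
      _ ≤ ‖V x‖ₑ + ‖V x - V n‖ₑ := enorm_sub_le
      _ ≤ _ := by gcongr
  calc ∑ n ∈ T, ‖V n‖ₑ ^ r
      ≤ ∑' n : ℤ, ∫⁻ x in Set.Ioc (-(1 / 2) + (n : ℝ)) (-(1 / 2) + n + 1),
          2 ^ (r - 1) * (‖V x‖ₑ ^ r + E x ^ r) := by
        refine le_trans (Finset.sum_le_sum fun n _ => ?_) (ENNReal.sum_le_tsum T)
        rw [← lintegral_Ioc_const n (‖V n‖ₑ ^ r)]
        exact setLIntegral_mono' measurableSet_Ioc (hpt n)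
    _ = 2 ^ (r - 1) * ((∫⁻ x, ‖V x‖ₑ ^ r) + ∫⁻ x, E x ^ r) := by
        rw [← lintegral_eq_tsum_Ioc, lintegral_const_mul' _ _ h2, lintegral_add_left (by fun_prop)]
    _ ≤ _ := by
        rw [mul_assoc, add_mul]
        gcongr
        · exact h S f
        · exact lintegral_sum_bump_rpow_le h1 S _

theorem DiscreteBound.kernelBound {r : ℝ} (h1 : 1 < r) {c : ℝ≥0∞} (h : DiscreteBound r c) :
    KernelBound r (fun x => (conjBump x : ℂ)) (2 ^ (r - 1) * (c + youngConst r)) := fun S f => by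
  set V : ℝ → ℂ := fun x => ∑ j ∈ S, f j * (conjBump (x - j) : ℂ) with hV
  set E : ℝ → ℝ≥0∞ := fun x => ∑ j ∈ S, ENNReal.ofReal (bump (x - j)) * ‖f j‖ₑ with hE
  have h2 : (2 : ℝ≥0∞) ^ (r - 1) ≠ ⊤ := ENNReal.rpow_ne_top_of_nonneg (by linarith) (by simp)
  have hpt : ∀ n : ℤ, ∀ x ∈ Set.Ioc (-(1 / 2) + (n : ℝ)) (-(1 / 2) + n + 1),
      ‖V x‖ₑ ^ r ≤ 2 ^ (r - 1) * (‖V n‖ₑ ^ r + E x ^ r) := fun n x hx => by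
    have hd := enorm_sum_conjBump_sub_le S f (abs_sub_le_of_mem_Ioc hx)
    refine le_trans (ENNReal.rpow_le_rpow ?_ (by linarith))
      (ENNReal.rpow_add_le_mul_rpow_add_rpow _ _ h1.le)
    calc ‖V x‖ₑ = ‖V n + (V x - V n)‖ₑ := by rw [add_sub_cancel]
      _ ≤ ‖V n‖ₑ + ‖V x - V n‖ₑ := enorm_add_le _ _
      _ ≤ _ := by gcongr
  calc ∫⁻ x, ‖V x‖ₑ ^ r
      ≤ ∑' n : ℤ, ∫⁻ x in Set.Ioc (-(1 / 2) + (n : ℝ)) (-(1 / 2) + n + 1),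
          2 ^ (r - 1) * (‖V n‖ₑ ^ r + E x ^ r) := by
        rw [lintegral_eq_tsum_Ioc]
        exact ENNReal.tsum_le_tsum fun n => setLIntegral_mono' measurableSet_Ioc (hpt n)
    _ = 2 ^ (r - 1) * (∑' n : ℤ, ‖V n‖ₑ ^ r + ∫⁻ x, E x ^ r) := by
        rw [lintegral_eq_tsum_Ioc, ← ENNReal.tsum_add, ← ENNReal.tsum_mul_left]
        refine tsum_congr fun n => ?_
        rw [lintegral_const_mul' _ _ h2, lintegral_add_left (by fun_prop), lintegral_Ioc_const]
    _ ≤ _ := by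
        rw [mul_assoc, add_mul]
        gcongr
        · exact ENNReal.summable.tsum_le_of_sum_le fun T => h T S f
        · exact lintegral_sum_bump_rpow_le h1 S _

theorem conjBump_neg (x : ℝ) : conjBump (-x) = -conjBump x := by
  unfold conjBump bump
  ring

/-- Oddness of the kernel makes the matrix antisymmetric, so up to sign it is its own transpose and
its `ℓ^r` bound follows from its `ℓ^q` bound by Hölder. -/
theorem DiscreteBound.dual {r q : ℝ} (hrq : r.HolderConjugate q) {c : ℝ≥0∞}
    (h : DiscreteBound q c) : DiscreteBound r (c ^ (r - 1)) := fun T S f => by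
  have hr := hrq.lt
  have hr0 := hrq.pos
  have hq0 := hrq.symm.pos
  set V : ℤ → ℂ := fun n => ∑ j ∈ S, f j * (conjBump (n - j) : ℂ) with hV
  -- The extremal test sequence: `V g = |V|^r` and `|g|^q = |V|^r`.
  set g : ℤ → ℂ := fun n => (starRingEnd ℂ) (V n) * ((‖V n‖ ^ (r - 2) : ℝ) : ℂ) with hg
  set W : ℤ → ℂ := fun j => ∑ n ∈ T, g n * (conjBump (j - n) : ℂ) with hW
  set N : ℝ≥0∞ := ∑ n ∈ T, ‖V n‖ₑ ^ r with hN
  set a : ℝ≥0∞ := ∑ j ∈ S, ‖f j‖ₑ ^ r with ha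
  have hpow : ∀ v : ℝ, 0 ≤ v → v * v ^ (r - 2) = v ^ (r - 1) := fun v hv => by
    rcases hv.eq_or_lt with rfl | hv
    · rw [zero_mul, Real.zero_rpow (by linarith)]
    · rw [mul_comm, ← Real.rpow_add_one hv.ne']
      congr 1
      ring
  have hpow' : ∀ v : ℝ, 0 ≤ v → v * v ^ (r - 1) = v ^ r := fun v hv => by
    rcases hv.eq_or_lt with rfl | hv
    · rw [zero_mul, Real.zero_rpow (by linarith)]
    · rw [mul_comm, ← Real.rpow_add_one hv.ne']
      congr 1
      ring
  have hgq : ∀ n, ‖g n‖ₑ ^ q = ‖V n‖ₑ ^ r := fun n => by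
    rw [← ofReal_norm, ← ofReal_norm, hg, norm_mul, RCLike.norm_conj, Complex.norm_real,
      Real.norm_of_nonneg (by positivity), hpow _ (norm_nonneg _),
      ENNReal.ofReal_rpow_of_nonneg (by positivity) hq0.le,
      ENNReal.ofReal_rpow_of_nonneg (by positivity) hr0.le, ← Real.rpow_mul (norm_nonneg _),
      hrq.sub_one_mul_conj]
  have hVg : ∀ n, ((‖V n‖ ^ r : ℝ) : ℂ) = V n * g n := fun n => by
    rw [hg]
    simp only
    rw [← mul_assoc, Complex.mul_conj, Complex.normSq_eq_norm_sq, ← hpow' _ (norm_nonneg _),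
      ← hpow _ (norm_nonneg _)]
    push_cast
    ring
  have hpair : ∑ n ∈ T, V n * g n = -∑ j ∈ S, f j * W j := by
    simp only [hV, hW, Finset.sum_mul, Finset.mul_sum]
    rw [Finset.sum_comm, ← Finset.sum_neg_distrib]
    refine Finset.sum_congr rfl fun j _ => ?_
    rw [← Finset.sum_neg_distrib]
    refine Finset.sum_congr rfl fun n _ => ?_
    rw [show ((n : ℝ) - j) = -(j - n) by ring, conjBump_neg]
    push_cast
    ring
  have hNle : N ≤ a ^ (1 / r) * (c * N) ^ (1 / q) := by
    calc N = ‖∑ n ∈ T, V n * g n‖ₑ := by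
          rw [← Finset.sum_congr rfl fun n _ => hVg n, ← Complex.ofReal_sum, ← ofReal_norm,
            Complex.norm_real, Real.norm_of_nonneg (Finset.sum_nonneg fun _ _ => by positivity),
            ENNReal.ofReal_sum_of_nonneg fun _ _ => by positivity]
          refine Finset.sum_congr rfl fun n _ => ?_
          rw [← ofReal_norm, ENNReal.ofReal_rpow_of_nonneg (norm_nonneg _) hr0.le]
      _ ≤ ∑ j ∈ S, ‖f j‖ₑ * ‖W j‖ₑ := by
          rw [hpair, enorm_neg]
          refine (enorm_sum_le _ _).trans (le_of_eq ?_)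
          simp only [enorm_mul]
      _ ≤ a ^ (1 / r) * (∑ j ∈ S, ‖W j‖ₑ ^ q) ^ (1 / q) := ENNReal.inner_le_Lp_mul_Lq _ _ _ hrq
      _ ≤ _ := by
          gcongr
          refine (h S T g).trans (le_of_eq ?_)
          simp only [hgq, hN]
  -- `T` is finite, so `N` is finite; this permits cancelling `N^(r - 1)` after raising the
  -- inequality for `N` to the power `r`.
  have hNtop : N ≠ ⊤ := by
    rw [hN]
    exact ENNReal.sum_ne_top.2 fun n _ => ENNReal.rpow_ne_top_of_nonneg hr0.le enorm_ne_top
  rcases eq_or_ne N 0 with h0 | h0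
  · rw [h0]
    exact zero_le
  have h5 : N * N ^ (r - 1) ≤ c ^ (r - 1) * a * N ^ (r - 1) := by
    have h6 := ENNReal.rpow_le_rpow hNle hr0.le
    rw [ENNReal.mul_rpow_of_nonneg _ _ hr0.le, ← ENNReal.rpow_mul, ← ENNReal.rpow_mul,
      one_div_mul_cancel hr0.ne', ENNReal.rpow_one,
      show 1 / q * r = r - 1 by have := hrq.sub_one_mul_conj; field_simp; linarith,
      ENNReal.mul_rpow_of_nonneg _ _ (by linarith)] at h6
    calc N * N ^ (r - 1) = N ^ r := by
          conv_lhs => rw [← ENNReal.rpow_one N]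
          rw [← ENNReal.rpow_mul, one_mul, ← ENNReal.rpow_add _ _ h0 hNtop]
          congr 1
          ring
      _ ≤ _ := h6.trans (le_of_eq (by ring))
  exact (ENNReal.mul_le_mul_iff_left (by simp [h0, hNtop])
    (ENNReal.rpow_ne_top_of_nonneg (by linarith) hNtop)).1 h5

/-- The operator with the conjugate Poisson kernel `x / (1 + x²)` is bounded on `ℓ^r`, `1 < r`. -/
theorem exists_kernelBound_conjBump {r : ℝ} (h1 : 1 < r) :
    ∃ c : ℝ≥0∞, c ≠ ⊤ ∧ KernelBound r (fun x => (conjBump x : ℂ)) c := by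
  rcases lt_or_ge r 3 with h3 | h3
  · exact exists_kernelBound_conjBump_of_lt_three h1 h3
  have hrq : r.HolderConjugate (Real.conjExponent r) := .conjExponent h1
  set q := Real.conjExponent r
  -- For `r ≥ 3` the conjugate exponent is at most `3/2`.
  have hq3 : q < 3 := by
    have := hrq.sub_one_mul_conj
    nlinarith [hrq.symm.pos]
  obtain ⟨c, hc, h⟩ := exists_kernelBound_conjBump_of_lt_three hrq.symm.lt hq3
  refine ⟨_, ?_, ((h.discreteBound hrq.symm.lt).dual hrq).kernelBound h1⟩
  have hy := youngConst_ne_top hrq.symm.lt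
  have hy' := youngConst_ne_top h1
  have h2 : ∀ s : ℝ, 1 < s → (2 : ℝ≥0∞) ^ (s - 1) ≠ ⊤ := fun s hs =>
    ENNReal.rpow_ne_top_of_nonneg (by linarith) (by simp)
  refine ENNReal.mul_ne_top (h2 r h1) (ENNReal.add_ne_top.2 ⟨?_, hy'⟩)
  exact ENNReal.rpow_ne_top_of_nonneg (by linarith)
    (ENNReal.mul_ne_top (h2 q hrq.symm.lt) (ENNReal.add_ne_top.2 ⟨hc, hy⟩))

/-! ### Multiplying kernels by Fourier transforms of measures. -/

theorem norm_exp_I_mul_mul (a b : ℝ) : ‖Complex.exp (Complex.I * a * b)‖ = 1 := by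
  rw [mul_assoc, ← Complex.ofReal_mul, mul_comm, Complex.norm_exp_ofReal_mul_I]

theorem enorm_exp_I_mul_mul (a b : ℝ) : ‖Complex.exp (Complex.I * a * b)‖ₑ = 1 := by
  rw [← ofReal_norm, norm_exp_I_mul_mul, ENNReal.ofReal_one]

/-- Multiplying the kernel by the Fourier transform of a complex measure of total mass `W` multiplies
the norm of the operator by at most `W`. -/
theorem KernelBound.mul_integral_exp {Ω : Type*} [MeasurableSpace Ω] {ν : Measure Ω} [SFinite ν]
    {r : ℝ} (h1 : 1 < r) {K : ℝ → ℂ} (hK : Measurable K) {c : ℝ≥0∞} (h : KernelBound r K c)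
    {w : Ω → ℂ} (hw : Integrable w ν) {θ : Ω → ℝ} (hθ : Measurable θ) :
    KernelBound r (fun x => K x * ∫ t, w t * Complex.exp (Complex.I * x * θ t) ∂ν)
      ((∫⁻ t, ‖w t‖ₑ ∂ν) ^ r * c) := fun S f => by
  set W := ∫⁻ t, ‖w t‖ₑ ∂ν with hW
  have hWtop : W ≠ ⊤ := hw.2.ne
  -- The factor `exp (i (x - j) θ)` splits: the part in `j` is absorbed into the data without
  -- changing moduli, and the part in `x` has modulus one. What remains is an average of the
  -- original operator over modulated data.
  set g : Ω → ℤ → ℂ := fun t j => f j * Complex.exp (Complex.I * (-j : ℝ) * θ t) with hg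
  set G : ℝ → Ω → ℂ := fun x t => ∑ j ∈ S, g t j * K (x - j) with hG
  have hint : ∀ y : ℝ, Integrable (fun t => w t * Complex.exp (Complex.I * y * θ t)) ν := fun y => by
    refine hw.mono (hw.1.mul (Measurable.aestronglyMeasurable (by fun_prop))) (ae_of_all _ fun t => ?_)
    rw [norm_mul, norm_exp_I_mul_mul, mul_one]
  have hrep : ∀ x : ℝ, ∑ j ∈ S, f j * (K (x - j) *
      ∫ t, w t * Complex.exp (Complex.I * (x - j : ℝ) * θ t) ∂ν) =
      ∫ t, w t * Complex.exp (Complex.I * x * θ t) * G x t ∂ν := fun x => by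
    simp only [hG, hg, Finset.mul_sum]
    rw [integral_finsetSum]
    · refine Finset.sum_congr rfl fun j _ => ?_
      rw [← mul_assoc, ← integral_const_mul]
      refine integral_congr_ae (ae_of_all _ fun t => ?_)
      simp only
      rw [show Complex.I * (x - j : ℝ) * θ t = Complex.I * x * θ t + Complex.I * (-j : ℝ) * θ t by
        push_cast; ring, Complex.exp_add]
      ring
    · intro j _
      refine ((hint (x - j)).const_mul (f j * K (x - j))).congr (ae_of_all _ fun t => ?_)
      simp only
      rw [show Complex.I * (x - j : ℝ) * θ t = Complex.I * x * θ t + Complex.I * (-j : ℝ) * θ t by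
        push_cast; ring, Complex.exp_add]
      ring
  have hGm : Measurable fun p : ℝ × Ω => G p.1 p.2 := by
    refine Finset.measurable_sum _ fun j _ => ?_
    have : Measurable fun p : ℝ × Ω => K (p.1 - j) := hK.comp (measurable_fst.sub_const _)
    exact Measurable.mul (by fun_prop) this
  have hpt : ∀ x : ℝ, ‖∑ j ∈ S, f j * (K (x - j) *
      ∫ t, w t * Complex.exp (Complex.I * (x - j : ℝ) * θ t) ∂ν)‖ₑ ^ r ≤
      W ^ (r - 1) * ∫⁻ t, ‖w t‖ₑ * ‖G x t‖ₑ ^ r ∂ν := fun x => by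
    rw [hrep]
    refine le_trans (ENNReal.rpow_le_rpow (enorm_integral_le_lintegral_enorm _) (by linarith)) ?_
    simp only [enorm_mul, enorm_exp_I_mul_mul, mul_one]
    exact lintegral_mul_rpow_le ν h1 hw.1.enorm (hGm.comp measurable_prodMk_left).enorm.aemeasurable
  calc ∫⁻ x : ℝ, ‖∑ j ∈ S, f j * (K (x - j) *
        ∫ t, w t * Complex.exp (Complex.I * (x - j : ℝ) * θ t) ∂ν)‖ₑ ^ r
      ≤ ∫⁻ x : ℝ, W ^ (r - 1) * ∫⁻ t, ‖w t‖ₑ * ‖G x t‖ₑ ^ r ∂ν := lintegral_mono hpt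
    _ = W ^ (r - 1) * ∫⁻ t, ‖w t‖ₑ * (∫⁻ x : ℝ, ‖G x t‖ₑ ^ r) ∂ν := by
        rw [lintegral_const_mul' _ _ (ENNReal.rpow_ne_top_of_nonneg (by linarith) hWtop),
          lintegral_lintegral_swap]
        · congr 1
          refine lintegral_congr fun t => ?_
          exact lintegral_const_mul _ ((hGm.comp measurable_prodMk_right).enorm.pow_const r)
        · exact (hw.1.enorm.comp_snd).mul (hGm.enorm.pow_const r).aemeasurable
    _ ≤ W ^ (r - 1) * ∫⁻ t, ‖w t‖ₑ * (c * ∑ j ∈ S, ‖f j‖ₑ ^ r) ∂ν := by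
        refine mul_le_mul_right (lintegral_mono fun t => mul_le_mul_right ?_ _) _
        refine (h S (g t)).trans (le_of_eq ?_)
        simp only [hg, enorm_mul, enorm_exp_I_mul_mul, mul_one]
    _ = W ^ r * c * ∑ j ∈ S, ‖f j‖ₑ ^ r := by
        rw [lintegral_mul_const'' _ hw.1.enorm, ← hW, ← mul_assoc, ← mul_assoc]
        congr 2
        rcases eq_or_ne W 0 with h0 | h0
        · rw [h0, mul_zero, ENNReal.zero_rpow_of_pos (by linarith)]
        · nth_rewrite 2 [← ENNReal.rpow_one W]
          rw [← ENNReal.rpow_add _ _ h0 hWtop, sub_add_cancel]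

/-- The purely atomic case, with counting measure on `ℤ` as the parameter space. -/
theorem KernelBound.mul_tsum_exp {r : ℝ} (h1 : 1 < r) {K : ℝ → ℂ} (hK : Measurable K) {c : ℝ≥0∞}
    (h : KernelBound r K c) {b : ℤ → ℂ} (hb : Summable b) (θ : ℤ → ℝ) :
    KernelBound r (fun x => K x * ∑' j, b j * Complex.exp (Complex.I * x * θ j))
      ((∑' j, ‖b j‖ₑ) ^ r * c) := by
  have hb' : Integrable b Measure.count := integrable_count_iff.2 hb.norm
  have := h.mul_integral_exp h1 hK hb' (θ := θ) .of_discrete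
  rw [lintegral_count] at this
  convert this using 4 with x
  rw [integral_countable]
  · simp
  · refine integrable_count_iff.2 ?_
    simpa only [norm_mul, norm_exp_I_mul_mul, mul_one] using hb.norm

/-- Because `1 = bump x + x * conjBump x`, the kernel splits into a part dominated by `bump` and a
part that sees only `x * L x`. -/
theorem kernelBound_of_mul_id {r : ℝ} (h1 : 1 < r) {L : ℝ → ℂ} (hL : Measurable L) {B : ℝ}
    (hB : ∀ x, ‖L x‖ ≤ B) {c : ℝ≥0∞} (h : KernelBound r (fun x => conjBump x * (x * L x)) c) :
    KernelBound r L (2 ^ (r - 1) * (ENNReal.ofReal B ^ r * youngConst r + c)) := by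
  have hb : KernelBound r (fun x => L x * bump x) (ENNReal.ofReal B ^ r * youngConst r) :=
    kernelBound_of_le_bump h1 fun x => by
      rw [norm_mul, Complex.norm_real, Real.norm_of_nonneg (bump_pos x).le]
      exact mul_le_mul_of_nonneg_right (hB x) (bump_pos x).le
  have hbm : Measurable fun x => (bump x : ℂ) :=
    (Complex.continuous_ofReal.comp continuous_bump).measurable
  convert hb.add h1 (hL.mul hbm) h using 2 with x
  change L x = L x * (bump x : ℂ) + conjBump x * (x * L x)
  have hne : ((1 + x ^ 2 : ℝ) : ℂ) ≠ 0 := by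
    exact_mod_cast (by positivity : (1 + x ^ 2 : ℝ) ≠ 0)
  unfold conjBump bump
  push_cast at hne ⊢
  field_simp

/-! ### Kernels of decay `(1 + x²)^(-1/2)` and convergence of their series. -/

theorem norm_le_mul_sqrt_bump {L : ℝ → ℂ} {B D : ℝ} (hB : ∀ x, ‖L x‖ ≤ B)
    (hD : ∀ x : ℝ, |x| * ‖L x‖ ≤ D) (x : ℝ) : ‖L x‖ ≤ (B + D) * bump x ^ (1 / 2 : ℝ) := by
  have hB0 : 0 ≤ B := (norm_nonneg _).trans (hB 0)
  have hD0 : 0 ≤ D := le_trans (by positivity) (hD 0)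
  have h : √(1 + x ^ 2) ≤ 1 + |x| := Real.sqrt_le_iff.2 ⟨by positivity, by
    nlinarith [abs_nonneg x, sq_abs x]⟩
  have hs : 0 < √(1 + x ^ 2) := Real.sqrt_pos.2 (by positivity)
  rw [← Real.sqrt_eq_rpow, bump, Real.sqrt_inv, ← div_eq_mul_inv, le_div_iff₀ hs]
  calc ‖L x‖ * √(1 + x ^ 2) ≤ ‖L x‖ * (1 + |x|) := by gcongr
    _ ≤ B + D := by linarith [hB x, hD x]

theorem summable_rpow_bump {q : ℝ} (hq : 1 < q) (x : ℝ) :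
    Summable fun j : ℤ => bump (x - j) ^ (q / 2) := by
  refine Summable.of_norm_bounded_eventually ((Real.summable_one_div_int_add_rpow (-x) q).2 hq) ?_
  have hfin : {j : ℤ | (j : ℝ) + -x = 0}.Finite := by
    refine Set.Subsingleton.finite fun a ha b hb => ?_
    simp only [Set.mem_ofPred_eq] at ha hb
    exact_mod_cast (by linarith : (a : ℝ) = b)
  filter_upwards [hfin.compl_mem_cofinite] with j hj
  have hj' : 0 < |(j : ℝ) + -x| := abs_pos.2 hj
  have hpow : 1 / |(j : ℝ) + -x| ^ q = ((|(j : ℝ) + -x| ^ 2)⁻¹) ^ (q / 2) := by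
    rw [Real.inv_rpow (by positivity), ← Real.rpow_natCast, ← Real.rpow_mul hj'.le, one_div]
    congr 2
    push_cast
    ring
  rw [Real.norm_of_nonneg (Real.rpow_nonneg (bump_pos _).le _), hpow]
  refine Real.rpow_le_rpow (bump_pos _).le (inv_anti₀ (by positivity) ?_) (by linarith)
  rw [sq_abs]
  nlinarith

/-- Hölder: the samples of `(1 + x²)^(-1/2)` along `x - ℤ` lie in `ℓ^q` for every `q > 1`. -/
theorem summable_mul_translate {r : ℝ} (h1 : 1 < r) {f : ℤ → ℂ}
    (hf : Summable fun j => ‖f j‖ ^ r) {L : ℝ → ℂ} {D : ℝ}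
    (hL : ∀ x, ‖L x‖ ≤ D * bump x ^ (1 / 2 : ℝ)) (x : ℝ) :
    Summable fun j : ℤ => f j * L (x - j) := by
  have hrq : r.HolderConjugate (Real.conjExponent r) := .conjExponent h1
  set q := Real.conjExponent r
  have hs : Summable fun j : ℤ => ‖f j‖ * bump (x - j) ^ (1 / 2 : ℝ) := by
    refine Real.summable_mul_of_Lp_Lq_of_nonneg hrq (fun j => norm_nonneg _)
      (fun j => Real.rpow_nonneg (bump_pos _).le _) hf ?_
    refine (summable_rpow_bump hrq.symm.lt x).congr fun j => ?_
    rw [← Real.rpow_mul (bump_pos _).le]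
    congr 1
    ring
  refine Summable.of_norm_bounded (hs.mul_left D) fun j => ?_
  rw [norm_mul, mul_left_comm]
  gcongr
  exact hL _

theorem measurable_tsum_translates {L : ℝ → ℂ} (hL : Measurable L) {f : ℤ → ℂ}
    (hs : ∀ x : ℝ, Summable fun j : ℤ => f j * L (x - j)) :
    Measurable fun x : ℝ => ∑' j : ℤ, f j * L (x - j) :=
  measurable_of_tendsto_metrizable' atTop (fun S => measurable_sum_translates hL S f)
    (tendsto_pi_nhds.2 fun x => (hs x).hasSum)

/-- Fatou's lemma along finite partial sums. -/
theorem KernelBound.lintegral_tsum_le {r : ℝ} {L : ℝ → ℂ} {c : ℝ≥0∞}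
    (h : KernelBound r L c) (hL : Measurable L) {f : ℤ → ℂ}
    (hs : ∀ x : ℝ, Summable fun j : ℤ => f j * L (x - j)) :
    ∫⁻ x : ℝ, ‖∑' j : ℤ, f j * L (x - j)‖ₑ ^ r ≤ c * ∑' j, ‖f j‖ₑ ^ r := by
  have hlim : ∀ x : ℝ, ‖∑' j : ℤ, f j * L (x - j)‖ₑ ^ r =
      liminf (fun S : Finset ℤ => ‖∑ j ∈ S, f j * L (x - j)‖ₑ ^ r) atTop := fun x =>
    (Tendsto.liminf_eq ((ENNReal.continuous_rpow_const.tendsto _).comp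
      ((continuous_enorm.tendsto _).comp (hs x).hasSum))).symm
  simp only [hlim]
  refine (lintegral_liminf_le fun S => (measurable_sum_translates hL S f).enorm.pow_const r).trans ?_
  refine liminf_le_of_le ⟨0, by simp⟩ fun b hb => ?_
  obtain ⟨S, hS⟩ := hb.exists
  exact hS.trans ((h S f).trans (by gcongr; exact ENNReal.sum_le_tsum S))

/-! ### The cardinal sine. -/

/-- The cardinal sine kernel. -/
def cardinalSinc (x : ℝ) : ℂ := (Real.sinc (Real.pi * x) : ℂ)

theorem continuous_cardinalSinc : Continuous cardinalSinc := by
  unfold cardinalSinc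
  have := Real.continuous_sinc
  fun_prop

theorem norm_cardinalSinc_le (x : ℝ) : ‖cardinalSinc x‖ ≤ 1 := by
  rw [cardinalSinc, Complex.norm_real]
  exact Real.abs_sinc_le_one _

theorem mul_cardinalSinc (x : ℝ) : (x : ℂ) * cardinalSinc x = (Real.sin (Real.pi * x) / Real.pi : ℝ) := by
  have hpi := Real.pi_ne_zero
  rcases eq_or_ne x 0 with rfl | hx
  · simp
  · rw [cardinalSinc, Real.sinc_of_ne_zero (by positivity), ← Complex.ofReal_mul]
    congr 1
    field_simp

theorem abs_mul_norm_cardinalSinc_le (x : ℝ) : |x| * ‖cardinalSinc x‖ ≤ 1 := by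
  rw [← Real.norm_eq_abs, ← Complex.norm_real, ← norm_mul, mul_cardinalSinc, Complex.norm_real,
    norm_div, Real.norm_of_nonneg Real.pi_pos.le, div_le_one Real.pi_pos, Real.norm_eq_abs]
  exact (Real.abs_sin_le_one _).trans (by linarith [Real.pi_gt_three])

theorem exists_kernelBound_cardinalSinc {r : ℝ} (h1 : 1 < r) :
    ∃ c : ℝ≥0∞, c ≠ ⊤ ∧ KernelBound r cardinalSinc c := by
  obtain ⟨c, hc, h⟩ := exists_kernelBound_conjBump h1
  -- `sin (πx) / π = (e^(iπx) - e^(-iπx)) / (2πi)`: a measure with two atoms, at `π` and `-π`.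
  set b : Bool → ℂ := fun i => (if i then 1 else -1) / (2 * Real.pi * Complex.I) with hb
  set θ : Bool → ℝ := fun i => if i then Real.pi else -Real.pi with hθ
  have hbi : Integrable b Measure.count := integrable_count_iff.2 (Summable.of_finite)
  have hm := h.mul_integral_exp h1 measurable_ofReal_conjBump hbi (θ := θ) .of_discrete
  have h2 : KernelBound r (fun x => conjBump x * (x * cardinalSinc x))
      ((∫⁻ t, ‖b t‖ₑ ∂Measure.count) ^ r * c) := by
    convert hm using 4 with x
    rw [mul_cardinalSinc, integral_fintype]
    have hpi : (Real.pi : ℂ) ≠ 0 := by exact_mod_cast Real.pi_ne_zero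
    simp [hb, hθ, Complex.sin]
    field_simp
    rw [Complex.I_sq]
    ring_nf
    exact integrable_count_iff.2 Summable.of_finite
  refine ⟨_, ?_, kernelBound_of_mul_id h1 continuous_cardinalSinc.measurable norm_cardinalSinc_le h2⟩
  have hr0 : 0 ≤ r := by linarith
  refine ENNReal.mul_ne_top (ENNReal.rpow_ne_top_of_nonneg (by linarith) (by simp))
    (ENNReal.add_ne_top.2 ⟨ENNReal.mul_ne_top (ENNReal.rpow_ne_top_of_nonneg hr0 (by simp))
      (youngConst_ne_top h1), ENNReal.mul_ne_top (ENNReal.rpow_ne_top_of_nonneg hr0 hbi.2.ne) hc⟩)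

/-! ### Periodization off the lattice `2πℤ`. -/

/-- The lattice `2πℤ`. -/
def latticeTwoPi : Set ℝ := Set.range fun n : ℤ => 2 * Real.pi * n

theorem isClosed_latticeTwoPi : IsClosed latticeTwoPi := by
  have h2 : (2 * Real.pi) ≠ 0 := by positivity
  exact ((isClosedMap_smul₀ (2 * Real.pi)).comp Int.isClosedEmbedding_coe_real.isClosedMap).isClosed_range

theorem isOpen_compl_latticeTwoPi : IsOpen latticeTwoPiᶜ := isClosed_latticeTwoPi.isOpen_compl

theorem volume_latticeTwoPi : volume latticeTwoPi = 0 := (Set.countable_range _).measure_zero _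

theorem ae_notMem_latticeTwoPi : ∀ᵐ x : ℝ, x ∉ latticeTwoPi :=
  compl_mem_ae_iff.2 volume_latticeTwoPi

theorem add_mem_latticeTwoPi_iff {u : ℝ} (l : ℤ) :
    u + 2 * Real.pi * l ∈ latticeTwoPi ↔ u ∈ latticeTwoPi := by
  constructor
  · rintro ⟨n, hn⟩
    exact ⟨n - l, by push_cast; simp only at hn; linarith⟩
  · rintro ⟨n, rfl⟩
    exact ⟨n + l, by push_cast; ring⟩

theorem ne_zero_of_notMem_latticeTwoPi {u : ℝ} (hu : u ∉ latticeTwoPi) : u ≠ 0 := by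
  rintro rfl
  exact hu ⟨0, by simp⟩

theorem add_ne_zero_of_notMem {u : ℝ} (hu : u ∉ latticeTwoPi) (j : ℤ) : u + 2 * Real.pi * j ≠ 0 :=
  ne_zero_of_notMem_latticeTwoPi (mt (add_mem_latticeTwoPi_iff j).1 hu)

theorem notMem_latticeTwoPi {u : ℝ} (hu : u ∈ Set.Icc (-Real.pi) Real.pi) (h0 : u ≠ 0) :
    u ∉ latticeTwoPi := by
  rintro ⟨n, rfl⟩
  have hpi := Real.pi_pos
  have h1 : (n : ℝ) < 1 := by nlinarith [hu.2]
  have h2 : (-1 : ℝ) < n := by nlinarith [hu.1]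
  have h3 : n < 1 := by exact_mod_cast h1
  have h4 : -1 < n := by exact_mod_cast h2
  have : n = 0 := by omega
  simp [this] at h0

/-- The part of `{δ ≤ |ξ|}` on which the asymptotic bound may fail lies in a compact set away from
`0`, where `h` is continuous. -/
theorem exists_bound_of_isBigO {h : ℝ → ℝ} (hc : ContinuousOn h {0}ᶜ) {s : ℝ}
    (hO : h =O[cocompact ℝ] fun ξ : ℝ => |ξ| ^ (-s)) {δ : ℝ} (hδ : 0 < δ) :
    ∃ C : ℝ, 0 ≤ C ∧ ∀ ξ : ℝ, δ ≤ |ξ| → |h ξ| ≤ C * |ξ| ^ (-s) := by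
  obtain ⟨c, hc0, hcO⟩ := hO.exists_pos
  obtain ⟨t, ht, hts⟩ := Filter.mem_cocompact.1 hcO.bound
  have hclosed : IsClosed {ξ : ℝ | δ ≤ |ξ|} := isClosed_le continuous_const continuous_abs
  have hne : ∀ ξ : ℝ, δ ≤ |ξ| → ξ ≠ 0 := fun ξ hξ => abs_pos.1 (hδ.trans_le hξ)
  obtain ⟨D, hD⟩ := (ht.inter_right hclosed).exists_bound_of_continuousOn
    (f := fun ξ => h ξ * |ξ| ^ s) ((hc.mono fun ξ hξ => hne ξ hξ.2).mul
      (ContinuousOn.rpow_const continuous_abs.continuousOn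
        fun ξ hξ => Or.inl (abs_pos.2 (hne ξ hξ.2)).ne'))
  refine ⟨max c D, hc0.le.trans (le_max_left _ _), fun ξ hξ => ?_⟩
  have hpos := hδ.trans_le hξ
  by_cases hξt : ξ ∈ t
  · have h1 := hD ξ ⟨hξt, hξ⟩
    rw [norm_mul, Real.norm_eq_abs, Real.norm_of_nonneg (by positivity)] at h1
    rw [Real.rpow_neg hpos.le, ← div_eq_mul_inv, le_div_iff₀ (by positivity)]
    exact h1.trans (le_max_right _ _)
  · have h1 : ‖h ξ‖ ≤ c * ‖|ξ| ^ (-s)‖ := hts hξt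
    rw [Real.norm_eq_abs, Real.norm_of_nonneg (by positivity)] at h1
    exact h1.trans (by gcongr; exact le_max_left _ _)

theorem exists_le_abs_add {u₀ : ℝ} (hu₀ : u₀ ∉ latticeTwoPi) :
    ∃ ρ > 0, ∃ c > 0, Metric.ball u₀ ρ ⊆ latticeTwoPiᶜ ∧
      ∀ u ∈ Metric.ball u₀ ρ, ∀ j : ℤ, c * (1 + |(j : ℝ)|) ≤ |u + 2 * Real.pi * j| := by
  obtain ⟨η, hη, hball⟩ := Metric.isOpen_iff.1 isOpen_compl_latticeTwoPi u₀ hu₀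
  have hρ : 0 < η / 2 := by positivity
  set ρ := η / 2 with hρdef
  -- Indices with `1 + |j| ≤ D` use only the distance `ρ` to the lattice. For larger `|j|` the term
  -- `2π|j|` dominates `|u|` and gives `|u + 2πj| ≥ 1 + |j|`.
  set D := 1 + ρ + (|u₀| + ρ) with hD
  have hDpos : 0 < D := by positivity
  refine ⟨ρ, hρ, ρ / D, by positivity, (Metric.ball_subset_ball (by linarith)).trans hball,
    fun u hu j => ?_⟩
  rw [Metric.mem_ball, Real.dist_eq] at hu
  have h1 : ρ ≤ |u + 2 * Real.pi * j| := by
    by_contra! hlt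
    have : -(2 * Real.pi * j) ∈ Metric.ball u₀ η := by
      rw [Metric.mem_ball, Real.dist_eq]
      calc |-(2 * Real.pi * j) - u₀| = |(u - u₀) - (u + 2 * Real.pi * j)| := by congr 1; ring
        _ ≤ |u - u₀| + |u + 2 * Real.pi * j| := abs_sub _ _
        _ < η := by linarith
    exact hball this ⟨-j, by push_cast; ring⟩
  have h2 : 2 * Real.pi * |(j : ℝ)| - (|u₀| + ρ) ≤ |u + 2 * Real.pi * j| := by
    have h3 : |2 * Real.pi * j| = 2 * Real.pi * |(j : ℝ)| := by
      rw [abs_mul, abs_of_pos (by positivity)]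
    have h4 : |2 * Real.pi * (j : ℝ)| ≤ |u + 2 * Real.pi * j| + |u| := by
      have := abs_sub (u + 2 * Real.pi * j) u
      rwa [add_sub_cancel_left] at this
    have h5 : |u| ≤ |u₀| + |u - u₀| := by
      have := abs_add_le u₀ (u - u₀)
      rwa [add_sub_cancel] at this
    linarith
  rw [div_mul_eq_mul_div, div_le_iff₀ hDpos]
  by_cases hj : |(j : ℝ)| ≤ ρ + (|u₀| + ρ)
  · calc ρ * (1 + |(j : ℝ)|) ≤ ρ * D := by gcongr; linarith
      _ ≤ _ := by gcongr
  · push Not at hj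
    have hj1 : 1 ≤ |(j : ℝ)| := by
      have hj0 : j ≠ 0 := by
        rintro rfl
        simp at hj
        linarith [abs_nonneg u₀]
      exact_mod_cast Int.one_le_abs hj0
    have hpi := Real.pi_gt_three
    have h6 : 1 + |(j : ℝ)| ≤ |u + 2 * Real.pi * j| := by nlinarith
    calc ρ * (1 + |(j : ℝ)|) ≤ D * |u + 2 * Real.pi * j| := by
          gcongr
          linarith [abs_nonneg u₀]
      _ = _ := mul_comm _ _

theorem summable_one_add_abs_rpow {s : ℝ} (hs : 1 < s) :
    Summable fun j : ℤ => (1 + |(j : ℝ)|) ^ (-s) := by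
  refine Summable.of_nonneg_of_le (fun j => by positivity) (fun j => ?_) (summable_rpow_bump hs 0)
  have h1 : (1 + |(j : ℝ)|) ^ (-s) = (((1 + |(j : ℝ)|) ^ 2)⁻¹) ^ (s / 2) := by
    rw [Real.inv_rpow (by positivity), ← Real.rpow_natCast, ← Real.rpow_mul (by positivity),
      ← Real.rpow_neg (by positivity)]
    congr 1
    push_cast
    ring
  rw [h1]
  refine Real.rpow_le_rpow (by positivity) (inv_anti₀ (by positivity) ?_) (by linarith)
  nlinarith [abs_nonneg (j : ℝ), sq_abs (j : ℝ)]

/-- A locally uniform Weierstrass majorant, which makes the periodization continuous and allows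
termwise differentiation off the lattice. -/
theorem exists_locally_summable_bound {h : ℝ → ℝ} (hc : ContinuousOn h {0}ᶜ) {s : ℝ} (hs : 1 < s)
    (hO : h =O[cocompact ℝ] fun ξ : ℝ => |ξ| ^ (-s)) {u₀ : ℝ} (hu₀ : u₀ ∉ latticeTwoPi) :
    ∃ ρ > 0, ∃ b : ℤ → ℝ, Summable b ∧ Metric.ball u₀ ρ ⊆ latticeTwoPiᶜ ∧
      ∀ u ∈ Metric.ball u₀ ρ, ∀ j : ℤ, |h (u + 2 * Real.pi * j)| ≤ b j := by
  obtain ⟨ρ, hρ, c, hc0, hball, hle⟩ := exists_le_abs_add hu₀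
  obtain ⟨C, hC, hb⟩ := exists_bound_of_isBigO hc hO hc0
  refine ⟨ρ, hρ, fun j => C * (c ^ (-s) * (1 + |(j : ℝ)|) ^ (-s)),
    ((summable_one_add_abs_rpow hs).mul_left _).mul_left _, hball, fun u hu j => ?_⟩
  have h1 := hle u hu j
  have h2 : c ≤ |u + 2 * Real.pi * j| := le_trans (by nlinarith [abs_nonneg (j : ℝ)]) h1
  refine (hb _ h2).trans ?_
  beta_reduce
  rw [← Real.mul_rpow hc0.le (by positivity)]
  exact mul_le_mul_of_nonneg_left (Real.rpow_le_rpow_of_nonpos (by positivity) h1 (by linarith)) hC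

/-- The periodization `∑ h(u + 2πj)`. -/
def periodization (h : ℝ → ℝ) (u : ℝ) : ℝ := ∑' j : ℤ, h (u + 2 * Real.pi * j)

theorem periodization_add (h : ℝ → ℝ) (u : ℝ) (l : ℤ) :
    periodization h (u + 2 * Real.pi * l) = periodization h u := by
  unfold periodization
  rw [← (Equiv.addLeft l).tsum_eq fun j : ℤ => h (u + 2 * Real.pi * j)]
  refine tsum_congr fun j => ?_
  simp only [Equiv.coe_addLeft]
  push_cast
  ring_nf

theorem summable_translates {h : ℝ → ℝ} (hc : ContinuousOn h {0}ᶜ) {s : ℝ} (hs : 1 < s)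
    (hO : h =O[cocompact ℝ] fun ξ : ℝ => |ξ| ^ (-s)) {u : ℝ} (hu : u ∉ latticeTwoPi) :
    Summable fun j : ℤ => h (u + 2 * Real.pi * j) := by
  obtain ⟨ρ, hρ, b, hb, -, hle⟩ := exists_locally_summable_bound hc hs hO hu
  exact Summable.of_norm_bounded hb fun j => hle u (Metric.mem_ball_self hρ) j

theorem continuousOn_periodization {h : ℝ → ℝ} (hc : ContinuousOn h {0}ᶜ) {s : ℝ} (hs : 1 < s)
    (hO : h =O[cocompact ℝ] fun ξ : ℝ => |ξ| ^ (-s)) :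
    ContinuousOn (periodization h) latticeTwoPiᶜ := fun u hu => by
  obtain ⟨ρ, hρ, b, hb, hball, hle⟩ := exists_locally_summable_bound hc hs hO hu
  refine ContinuousAt.continuousWithinAt (ContinuousOn.continuousAt (s := Metric.ball u ρ) ?_
    (Metric.ball_mem_nhds u hρ))
  refine continuousOn_tsum (fun j => ?_) hb fun j x hx => hle x hx j
  exact hc.comp (by fun_prop) fun x hx => add_ne_zero_of_notMem (hball hx) j

theorem hasDerivAt_periodization {h : ℝ → ℝ} (hC : ContDiffOn ℝ 1 h {0}ᶜ) {s : ℝ} (hs : 1 < s)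
    (hO : h =O[cocompact ℝ] fun ξ : ℝ => |ξ| ^ (-s))
    (hO' : deriv h =O[cocompact ℝ] fun ξ : ℝ => |ξ| ^ (-s)) {u : ℝ} (hu : u ∉ latticeTwoPi) :
    HasDerivAt (periodization h) (periodization (deriv h) u) u := by
  have hc' : ContinuousOn (deriv h) {0}ᶜ :=
    hC.continuousOn_deriv_of_isOpen isOpen_compl_singleton le_rfl
  obtain ⟨ρ, hρ, b, hb, hball, hle⟩ := exists_locally_summable_bound hc' hs hO' hu
  refine hasDerivAt_tsum_of_isPreconnected (g := fun (j : ℤ) y => h (y + 2 * Real.pi * j))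
    (g' := fun (j : ℤ) y => deriv h (y + 2 * Real.pi * j)) hb Metric.isOpen_ball
    (convex_ball u ρ).isPreconnected
    (fun j y hy => ?_) (fun j y hy => hle y hy j) (Metric.mem_ball_self hρ)
    (summable_translates hC.continuousOn hs hO hu) (Metric.mem_ball_self hρ)
  have hd : DifferentiableAt ℝ h (y + 2 * Real.pi * j) :=
    (hC.differentiableOn one_ne_zero).differentiableAt
      (isOpen_compl_singleton.mem_nhds (add_ne_zero_of_notMem (hball hy) j))
  exact hd.hasDerivAt.comp_add_const y (2 * Real.pi * (j : ℝ))

theorem exists_add_mem_Icc (u : ℝ) :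
    ∃ l : ℤ, u + 2 * Real.pi * l ∈ Set.Icc (-Real.pi) Real.pi := by
  have hpi := Real.pi_pos
  refine ⟨-round (u / (2 * Real.pi)), ?_⟩
  have h := abs_le.1 (abs_sub_round (u / (2 * Real.pi)))
  have h1 : u = 2 * Real.pi * (u / (2 * Real.pi)) := by field_simp
  set v := u / (2 * Real.pi)
  push_cast
  constructor
  · nlinarith [h.1]
  · nlinarith [h.2]

theorem image_add_Ioc (j : ℤ) :
    (fun x : ℝ => x + 2 * Real.pi * j) '' Set.Ioc (-Real.pi) Real.pi =
      Set.Ioc (-Real.pi + j • (2 * Real.pi)) (-Real.pi + (j + 1) • (2 * Real.pi)) := by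
  rw [Set.image_add_const_Ioc]
  simp only [zsmul_eq_mul, Int.cast_add, Int.cast_one]
  ring_nf

theorem lintegral_eq_tsum_translates (h : ℝ → ℝ≥0∞) :
    ∫⁻ x, h x = ∑' j : ℤ, ∫⁻ u in Set.Icc (-Real.pi) Real.pi, h (u + 2 * Real.pi * j) := by
  have hp : (0 : ℝ) < 2 * Real.pi := by positivity
  rw [← setLIntegral_univ, ← iUnion_Ioc_add_zsmul hp (-Real.pi),
    lintegral_iUnion (fun n => measurableSet_Ioc) (Set.pairwise_disjoint_Ioc_add_zsmul _ _)]
  refine tsum_congr fun j => ?_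
  rw [← restrict_Ioc_eq_restrict_Icc, ← image_add_Ioc]
  exact ((measurePreserving_add_right volume (2 * Real.pi * (j : ℝ))).setLIntegral_comp_emb
    (measurableEmbedding_addRight _) _ _).symm

theorem hasSum_integral_translates {E : Type*} [NormedAddCommGroup E] [NormedSpace ℝ E]
    {h : ℝ → E} (hi : Integrable h) :
    HasSum (fun j : ℤ => ∫ u in Set.Icc (-Real.pi) Real.pi, h (u + 2 * Real.pi * j)) (∫ x, h x) := by
  have hp : (0 : ℝ) < 2 * Real.pi := by positivity
  have h1 := hasSum_integral_iUnion (f := h) (μ := volume) (fun n : ℤ => measurableSet_Ioc)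
    (Set.pairwise_disjoint_Ioc_add_zsmul (-Real.pi) (2 * Real.pi))
    (by rw [iUnion_Ioc_add_zsmul hp]; exact hi.integrableOn)
  rw [iUnion_Ioc_add_zsmul hp, setIntegral_univ] at h1
  convert h1 using 2 with j
  rw [← restrict_Ioc_eq_restrict_Icc, ← image_add_Ioc]
  exact ((measurePreserving_add_right volume (2 * Real.pi * (j : ℝ))).setIntegral_image_emb
    (measurableEmbedding_addRight _) _ _).symm

/-! ### Integrability of the transform of the fundamental function and of its derivative. -/

/-- The constant `(2π)^(-1/2)`. -/
def invSqrtTwoPi : ℝ := (√(2 * Real.pi))⁻¹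

theorem invSqrtTwoPi_pos : 0 < invSqrtTwoPi := by unfold invSqrtTwoPi; positivity

theorem invSqrtTwoPi_mul_self : invSqrtTwoPi * invSqrtTwoPi * (2 * Real.pi) = 1 := by
  unfold invSqrtTwoPi
  rw [← mul_inv, Real.mul_self_sqrt (by positivity), inv_mul_cancel₀ (by positivity)]

theorem fundamentalHat_eq (g : ℝ → ℝ) (ξ : ℝ) :
    fundamentalHat g ξ = invSqrtTwoPi * (g ξ / periodization g ξ) := rfl

/-- The derivative of `fundamentalHat g` off the lattice `2πℤ`. -/
def fundamentalHatDeriv (g : ℝ → ℝ) (ξ : ℝ) : ℝ :=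
  invSqrtTwoPi * ((deriv g ξ * periodization g ξ - g ξ * periodization (deriv g) ξ) /
    periodization g ξ ^ 2)

theorem restrict_compl_latticeTwoPi : (volume : Measure ℝ).restrict latticeTwoPiᶜ = volume :=
  Measure.restrict_eq_self_of_ae_mem (s := latticeTwoPiᶜ) ae_notMem_latticeTwoPi

variable {φ g : ℝ → ℝ}

namespace InterpolatingConditions

theorem continuousOn (h : InterpolatingConditions φ g) : ContinuousOn g {0}ᶜ :=
  h.contDiffOn.continuousOn

theorem continuousOn_deriv (h : InterpolatingConditions φ g) : ContinuousOn (deriv g) {0}ᶜ :=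
  h.contDiffOn.continuousOn_deriv_of_isOpen isOpen_compl_singleton le_rfl

theorem measurable (h : InterpolatingConditions φ g) : Measurable g :=
  measurable_of_continuousOn_compl_singleton 0 h.continuousOn

theorem summable (h : InterpolatingConditions φ g) {u : ℝ} (hu : u ∉ latticeTwoPi) :
    Summable fun j : ℤ => g (u + 2 * Real.pi * j) := by
  obtain ⟨ε, hε, hO, -⟩ := h.decay
  exact summable_translates h.continuousOn (by linarith) hO hu

theorem summable_deriv (h : InterpolatingConditions φ g) {u : ℝ} (hu : u ∉ latticeTwoPi) :
    Summable fun j : ℤ => deriv g (u + 2 * Real.pi * j) := by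
  obtain ⟨ε, hε, -, hO⟩ := h.decay
  exact summable_translates h.continuousOn_deriv (by linarith) hO hu

theorem pos (h : InterpolatingConditions φ g) {u : ℝ} (hu : u ∈ Set.Icc (-Real.pi) Real.pi)
    (h0 : u ≠ 0) : 0 < g u := by
  obtain ⟨m, hm, hle⟩ := h.lower_bound
  exact hm.trans_le (hle u hu h0)

theorem le_periodization (h : InterpolatingConditions φ g) {u : ℝ} (hu : u ∉ latticeTwoPi) :
    g u ≤ periodization g u := by
  have := (h.summable hu).le_tsum 0 fun j _ => h.nonneg _ (add_ne_zero_of_notMem hu j)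
  unfold periodization
  simpa using this

theorem periodization_pos (h : InterpolatingConditions φ g) {u : ℝ} (hu : u ∉ latticeTwoPi) :
    0 < periodization g u := by
  obtain ⟨l, hl⟩ := exists_add_mem_Icc u
  have hu' : u + 2 * Real.pi * l ∉ latticeTwoPi := mt (add_mem_latticeTwoPi_iff l).1 hu
  rw [← periodization_add g u l]
  exact (h.pos hl (ne_zero_of_notMem_latticeTwoPi hu')).trans_le (h.le_periodization hu')

theorem hasDerivAt_fundamentalHat (h : InterpolatingConditions φ g) {u : ℝ} (hu : u ∉ latticeTwoPi) :
    HasDerivAt (fundamentalHat g) (fundamentalHatDeriv g u) u := by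
  obtain ⟨ε, hε, hO, hO'⟩ := h.decay
  have h1 := hasDerivAt_periodization h.contDiffOn (by linarith) hO hO' hu
  have h2 : HasDerivAt g (deriv g u) u :=
    ((h.contDiffOn.differentiableOn one_ne_zero).differentiableAt
      (isOpen_compl_singleton.mem_nhds (ne_zero_of_notMem_latticeTwoPi hu))).hasDerivAt
  exact (h2.div h1 (h.periodization_pos hu).ne').const_mul invSqrtTwoPi

theorem continuousOn_fundamentalHatDeriv (h : InterpolatingConditions φ g) :
    ContinuousOn (fundamentalHatDeriv g) latticeTwoPiᶜ := by
  obtain ⟨ε, hε, hO, hO'⟩ := h.decay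
  have h1 := continuousOn_periodization h.continuousOn (by linarith) hO
  have h2 := continuousOn_periodization h.continuousOn_deriv (by linarith) hO'
  have hsub : latticeTwoPiᶜ ⊆ {0}ᶜ := fun u hu => ne_zero_of_notMem_latticeTwoPi hu
  have h3 := h.continuousOn.mono hsub
  have h4 := h.continuousOn_deriv.mono hsub
  exact continuousOn_const.mul (((h4.mul h1).sub (h3.mul h2)).div (h1.pow 2)
    fun u hu => (pow_pos (h.periodization_pos hu) 2).ne')

theorem fundamentalHat_nonneg (h : InterpolatingConditions φ g) {u : ℝ} (hu : u ∉ latticeTwoPi) :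
    0 ≤ fundamentalHat g u := by
  rw [fundamentalHat_eq]
  exact mul_nonneg invSqrtTwoPi_pos.le
    (div_nonneg (h.nonneg _ (ne_zero_of_notMem_latticeTwoPi hu)) (h.periodization_pos hu).le)

theorem ratio_nonneg (h : InterpolatingConditions φ g) (j : ℤ) {u : ℝ}
    (hu : u ∈ Set.Icc (-Real.pi) Real.pi) (h0 : u ≠ 0) : 0 ≤ ratio g j u :=
  div_nonneg (h.nonneg _ (add_ne_zero_of_notMem (notMem_latticeTwoPi hu h0) j)) (h.pos hu h0).le

theorem fundamentalHat_add_eq (h : InterpolatingConditions φ g) (j : ℤ) {u : ℝ}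
    (hu : u ∈ Set.Icc (-Real.pi) Real.pi) (h0 : u ≠ 0) :
    fundamentalHat g (u + 2 * Real.pi * j) =
      invSqrtTwoPi * (ratio g j u * (g u / periodization g u)) := by
  have h1 := h.pos hu h0
  rw [fundamentalHat_eq, periodization_add, ratio]
  field_simp

theorem fundamentalHat_add_le (h : InterpolatingConditions φ g) (j : ℤ) {u : ℝ}
    (hu : u ∈ Set.Icc (-Real.pi) Real.pi) (h0 : u ≠ 0) :
    fundamentalHat g (u + 2 * Real.pi * j) ≤ invSqrtTwoPi * ratio g j u := by
  have hu' := notMem_latticeTwoPi hu h0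
  rw [h.fundamentalHat_add_eq j hu h0]
  refine mul_le_mul_of_nonneg_left (mul_le_of_le_one_right (h.ratio_nonneg j hu h0) ?_)
    invSqrtTwoPi_pos.le
  exact (div_le_one (h.periodization_pos hu')).2 (h.le_periodization hu')

theorem ae_ne_zero_Icc : ∀ᵐ u ∂(volume.restrict (Set.Icc (-Real.pi) Real.pi)),
    u ∈ Set.Icc (-Real.pi) Real.pi ∧ u ≠ 0 := by
  filter_upwards [ae_restrict_mem measurableSet_Icc,
    ae_restrict_of_ae (compl_mem_ae_iff.2 (measure_singleton (0 : ℝ)))] with u h1 h2 using ⟨h1, h2⟩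

/-- Write `P` for the periodization. Dividing numerator and denominator of the quotient rule by `g u
^ 2` leaves `(g / P)²`, at most 1, times `∑ₖ (ratio k · derivRatio j - ratio j · derivRatio k)`. The
diagonal term cancels, which is why (B2) need only control `k ≠ j`. -/
theorem enorm_fundamentalHatDeriv_add_le (h : InterpolatingConditions φ g) (j : ℤ) {u : ℝ}
    (hu : u ∈ Set.Icc (-Real.pi) Real.pi) (h0 : u ≠ 0) :
    ‖fundamentalHatDeriv g (u + 2 * Real.pi * j)‖ₑ ≤ ENNReal.ofReal invSqrtTwoPi *
      ∑' k : {k : ℤ // k ≠ j}, (‖ratio g k u * derivRatio g j u‖ₑ +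
        ‖ratio g j u * derivRatio g k u‖ₑ) := by
  have hu' := notMem_latticeTwoPi hu h0
  have hg := h.pos hu h0
  have hP := h.periodization_pos hu'
  set F : ℤ → ℝ := fun k => ratio g k u * derivRatio g j u - ratio g j u * derivRatio g k u with hF
  have hsum : HasSum F (derivRatio g j u * (periodization g u / g u) -
      ratio g j u * (periodization (deriv g) u / g u)) := by
    have h1 := ((h.summable hu').hasSum.div_const (g u)).mul_right (derivRatio g j u)
    have h2 := ((h.summable_deriv hu').hasSum.div_const (g u)).mul_left (ratio g j u)
    rw [mul_comm (derivRatio g j u)]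
    exact h1.sub h2
  have hrep : fundamentalHatDeriv g (u + 2 * Real.pi * j) =
      invSqrtTwoPi * ((g u / periodization g u) ^ 2 * ∑' k, F k) := by
    rw [hsum.tsum_eq, fundamentalHatDeriv, periodization_add, periodization_add, ratio, derivRatio]
    field_simp
  have hq : ‖(g u / periodization g u) ^ 2‖ₑ ≤ 1 := by
    rw [Real.enorm_eq_ofReal (by positivity), ENNReal.ofReal_le_one]
    exact pow_le_one₀ (by positivity) ((div_le_one hP).2 (h.le_periodization hu'))
  have hsupp : ∑' k, ‖F k‖ₑ = ∑' k : {k : ℤ // k ≠ j}, ‖F k‖ₑ := by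
    refine (tsum_subtype_eq_of_support_subset (s := {k : ℤ | k ≠ j}) fun k hk => ?_).symm
    rintro rfl
    simp [hF] at hk
  rw [hrep, enorm_mul, enorm_mul, Real.enorm_eq_ofReal invSqrtTwoPi_pos.le]
  gcongr
  calc ‖(g u / periodization g u) ^ 2‖ₑ * ‖∑' k, F k‖ₑ ≤ 1 * ∑' k, ‖F k‖ₑ := by
        gcongr
        exact enorm_tsum_le_tsum_enorm
    _ ≤ _ := by
        rw [one_mul, hsupp]
        exact ENNReal.tsum_le_tsum fun k => enorm_sub_le

theorem measurable_ratio (h : InterpolatingConditions φ g) (j : ℤ) : Measurable (ratio g j) :=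
  (h.measurable.comp (measurable_id.add_const _)).div h.measurable

theorem measurable_derivRatio (h : InterpolatingConditions φ g) (j : ℤ) :
    Measurable (derivRatio g j) :=
  ((measurable_deriv g).comp (measurable_id.add_const _)).div h.measurable

theorem lintegral_fundamentalHatDeriv_le (h : InterpolatingConditions φ g) {C : ℝ≥0∞}
    (hC : ∑' j : ℤ, ∑' k : {k : ℤ // k ≠ j}, ∫⁻ u in Set.Icc (-Real.pi) Real.pi,
        ‖ratio g j u * derivRatio g k u‖ₑ ≤ C) :
    ∫⁻ ξ, ‖fundamentalHatDeriv g ξ‖ₑ ≤ ENNReal.ofReal invSqrtTwoPi * (C + C) := by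
  set T : ℤ → ℤ → ℝ≥0∞ := fun j k => ∫⁻ u in Set.Icc (-Real.pi) Real.pi,
    ‖ratio g j u * derivRatio g k u‖ₑ with hT
  have hmeas : ∀ j k : ℤ, Measurable fun u => ‖ratio g j u * derivRatio g k u‖ₑ := fun j k =>
    ((h.measurable_ratio j).mul (h.measurable_derivRatio k)).enorm
  -- The two off-diagonal sums are the (B2) sum and its transpose, equal by Tonelli; hence the bound
  -- `C + C`.
  have hswap : ∑' j : ℤ, ∑' k : {k : ℤ // k ≠ j}, T k j = ∑' j : ℤ, ∑' k : {k : ℤ // k ≠ j}, T j k := by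
    have e1 : ∀ (j : ℤ) (f : ℤ → ℝ≥0∞), ∑' k : {k : ℤ // k ≠ j}, f k =
        ∑' k : ℤ, if k ≠ j then f k else 0 := fun j f => by
      refine (tsum_subtype {k : ℤ | k ≠ j} f).trans ?_
      refine tsum_congr fun k => ?_
      simp [Set.indicator_apply]
    simp only [fun j => e1 j fun k => T k j, fun j => e1 j fun k => T j k]
    rw [ENNReal.tsum_comm]
    simp only [ne_comm]
  calc ∫⁻ ξ, ‖fundamentalHatDeriv g ξ‖ₑ
      = ∑' j : ℤ, ∫⁻ u in Set.Icc (-Real.pi) Real.pi,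
          ‖fundamentalHatDeriv g (u + 2 * Real.pi * j)‖ₑ := lintegral_eq_tsum_translates _
    _ ≤ ∑' j : ℤ, ∫⁻ u in Set.Icc (-Real.pi) Real.pi, ENNReal.ofReal invSqrtTwoPi *
          ∑' k : {k : ℤ // k ≠ j}, (‖ratio g k u * derivRatio g j u‖ₑ +
            ‖ratio g j u * derivRatio g k u‖ₑ) := by
        refine ENNReal.tsum_le_tsum fun j => lintegral_mono_ae ?_
        filter_upwards [ae_ne_zero_Icc] with u hu
        exact h.enorm_fundamentalHatDeriv_add_le j hu.1 hu.2
    _ = ENNReal.ofReal invSqrtTwoPi * (∑' j : ℤ, ∑' k : {k : ℤ // k ≠ j}, T k j +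
          ∑' j : ℤ, ∑' k : {k : ℤ // k ≠ j}, T j k) := by
        rw [← ENNReal.tsum_add, ← ENNReal.tsum_mul_left]
        refine tsum_congr fun j => ?_
        have hm : ∀ k : {k : ℤ // k ≠ j}, AEMeasurable (fun u => ‖ratio g k u * derivRatio g j u‖ₑ +
            ‖ratio g j u * derivRatio g k u‖ₑ) (volume.restrict (Set.Icc (-Real.pi) Real.pi)) :=
          fun k => ((hmeas k j).add (hmeas j k)).aemeasurable
        rw [lintegral_const_mul' _ _ ENNReal.ofReal_ne_top, lintegral_tsum hm, ← ENNReal.tsum_add]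
        congr 1
        exact tsum_congr fun k => lintegral_add_left (hmeas k j) _
    _ ≤ _ := by
        rw [hswap]
        gcongr

theorem integrable_fundamentalHatDeriv (h : InterpolatingConditions φ g) {C : ℝ≥0∞} (hCt : C ≠ ⊤)
    (hC : ∑' j : ℤ, ∑' k : {k : ℤ // k ≠ j}, ∫⁻ u in Set.Icc (-Real.pi) Real.pi,
        ‖ratio g j u * derivRatio g k u‖ₑ ≤ C) :
    Integrable (fundamentalHatDeriv g) := by
  refine ⟨?_, (h.lintegral_fundamentalHatDeriv_le hC).trans_lt
    (ENNReal.mul_lt_top ENNReal.ofReal_lt_top (ENNReal.add_lt_top.2 ⟨hCt.lt_top, hCt.lt_top⟩))⟩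
  have := h.continuousOn_fundamentalHatDeriv.aestronglyMeasurable
    isOpen_compl_latticeTwoPi.measurableSet (μ := volume)
  rwa [restrict_compl_latticeTwoPi] at this

theorem aestronglyMeasurable_fundamentalHat (h : InterpolatingConditions φ g) :
    AEStronglyMeasurable (fundamentalHat g) := by
  have hc : ContinuousOn (fundamentalHat g) latticeTwoPiᶜ := fun u hu =>
    (h.hasDerivAt_fundamentalHat hu).continuousAt.continuousWithinAt
  have := hc.aestronglyMeasurable isOpen_compl_latticeTwoPi.measurableSet (μ := volume)
  rwa [restrict_compl_latticeTwoPi] at this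

theorem dominant_nonneg (h : InterpolatingConditions φ g) {M : ℤ → ℝ}
    (hM : ∀ j : ℤ, ∀ u ∈ Set.Icc (-Real.pi) Real.pi, u ≠ 0 → ratio g j u ≤ M j) (j : ℤ) :
    0 ≤ M j := by
  have h1 : (1 : ℝ) ∈ Set.Icc (-Real.pi) Real.pi :=
    ⟨by linarith [Real.pi_gt_three], by linarith [Real.pi_gt_three]⟩
  exact (h.ratio_nonneg j h1 one_ne_zero).trans (hM j 1 h1 one_ne_zero)

/-- On the cell around `2πj` the transform is at most `(2π)^(-1/2) M j`, and each cell has length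
`2π`. -/
theorem lintegral_fundamentalHat_le (h : InterpolatingConditions φ g) {M : ℤ → ℝ} (hMs : Summable M)
    (hM : ∀ j : ℤ, ∀ u ∈ Set.Icc (-Real.pi) Real.pi, u ≠ 0 → ratio g j u ≤ M j) :
    ∫⁻ ξ, ‖fundamentalHat g ξ‖ₑ ≤ ENNReal.ofReal (invSqrtTwoPi * (2 * Real.pi) * ∑' j, M j) := by
  have hM0 := h.dominant_nonneg hM
  have hκ := invSqrtTwoPi_pos
  calc ∫⁻ ξ, ‖fundamentalHat g ξ‖ₑ
      = ∑' j : ℤ, ∫⁻ u in Set.Icc (-Real.pi) Real.pi, ‖fundamentalHat g (u + 2 * Real.pi * j)‖ₑ :=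
        lintegral_eq_tsum_translates _
    _ ≤ ∑' j : ℤ, ∫⁻ _ in Set.Icc (-Real.pi) Real.pi, ENNReal.ofReal (invSqrtTwoPi * M j) := by
        refine ENNReal.tsum_le_tsum fun j => lintegral_mono_ae ?_
        filter_upwards [ae_ne_zero_Icc] with u hu
        have hu' := mt (add_mem_latticeTwoPi_iff j).1 (notMem_latticeTwoPi hu.1 hu.2)
        rw [Real.enorm_eq_ofReal (h.fundamentalHat_nonneg hu')]
        refine ENNReal.ofReal_le_ofReal ((h.fundamentalHat_add_le j hu.1 hu.2).trans ?_)
        exact mul_le_mul_of_nonneg_left (hM j u hu.1 hu.2) hκ.le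
    _ = ∑' j : ℤ, ENNReal.ofReal (invSqrtTwoPi * (2 * Real.pi) * M j) := by
        refine tsum_congr fun j => ?_
        rw [setLIntegral_const, Real.volume_Icc, ← ENNReal.ofReal_mul (mul_nonneg hκ.le (hM0 j))]
        congr 1
        ring
    _ = _ := by
        rw [← tsum_mul_left, ENNReal.ofReal_tsum_of_nonneg
          (fun j => mul_nonneg (by positivity) (hM0 j)) (hMs.mul_left _)]

theorem integrable_fundamentalHat (h : InterpolatingConditions φ g) {M : ℤ → ℝ} (hMs : Summable M)
    (hM : ∀ j : ℤ, ∀ u ∈ Set.Icc (-Real.pi) Real.pi, u ≠ 0 → ratio g j u ≤ M j) :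
    Integrable (fundamentalHat g) :=
  ⟨h.aestronglyMeasurable_fundamentalHat,
    (h.lintegral_fundamentalHat_le hMs hM).trans_lt ENNReal.ofReal_lt_top⟩

theorem integrable_fundamentalHat_mul_exp (h : InterpolatingConditions φ g) {M : ℤ → ℝ}
    (hMs : Summable M)
    (hM : ∀ j : ℤ, ∀ u ∈ Set.Icc (-Real.pi) Real.pi, u ≠ 0 → ratio g j u ≤ M j) (x : ℝ) :
    Integrable fun ξ : ℝ => (fundamentalHat g ξ : ℂ) * Complex.exp (Complex.I * x * ξ) := by
  have hi := h.integrable_fundamentalHat hMs hM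
  refine hi.mono (hi.ofReal.1.mul (Continuous.aestronglyMeasurable (by fun_prop)))
    (ae_of_all _ fun ξ => ?_)
  rw [norm_mul, norm_exp_I_mul_mul, mul_one, Complex.norm_real]

theorem norm_fundamental_le (h : InterpolatingConditions φ g) {M : ℤ → ℝ} (hMs : Summable M)
    (hM : ∀ j : ℤ, ∀ u ∈ Set.Icc (-Real.pi) Real.pi, u ≠ 0 → ratio g j u ≤ M j) (x : ℝ) :
    ‖fundamental g x‖ ≤ ∑' j, M j := by
  have hM0 : 0 ≤ ∑' j, M j := tsum_nonneg (h.dominant_nonneg hM)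
  have hκ := invSqrtTwoPi_pos
  have h1 : ‖∫ ξ : ℝ, (fundamentalHat g ξ : ℂ) * Complex.exp (Complex.I * x * ξ)‖ ≤
      invSqrtTwoPi * (2 * Real.pi) * ∑' j, M j := by
    rw [← ENNReal.ofReal_le_ofReal_iff (by positivity), ofReal_norm]
    refine (enorm_integral_le_lintegral_enorm _).trans ?_
    simp only [enorm_mul, enorm_exp_I_mul_mul, mul_one]
    refine le_trans (le_of_eq ?_) (h.lintegral_fundamentalHat_le hMs hM)
    refine lintegral_congr fun ξ => ?_
    rw [← ofReal_norm, Complex.norm_real, ofReal_norm]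
  change ‖(invSqrtTwoPi : ℂ) * _‖ ≤ _
  rw [norm_mul, Complex.norm_real, Real.norm_of_nonneg hκ.le]
  calc _ ≤ invSqrtTwoPi * (invSqrtTwoPi * (2 * Real.pi) * ∑' j, M j) := by gcongr
    _ = (invSqrtTwoPi * invSqrtTwoPi * (2 * Real.pi)) * ∑' j, M j := by ring
    _ = _ := by rw [invSqrtTwoPi_mul_self, one_mul]

theorem continuous_fundamental (h : InterpolatingConditions φ g) {M : ℤ → ℝ} (hMs : Summable M)
    (hM : ∀ j : ℤ, ∀ u ∈ Set.Icc (-Real.pi) Real.pi, u ≠ 0 → ratio g j u ≤ M j) :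
    Continuous (fundamental g) := by
  have hi := h.integrable_fundamentalHat hMs hM
  refine continuous_const.mul (continuous_of_dominated (bound := fun ξ => ‖fundamentalHat g ξ‖)
    (fun x => (h.integrable_fundamentalHat_mul_exp hMs hM x).1) (fun x => ae_of_all _ fun ξ => ?_)
    hi.norm (ae_of_all _ fun ξ => by fun_prop))
  rw [norm_mul, norm_exp_I_mul_mul, mul_one, Complex.norm_real]

end InterpolatingConditions

/-! ### One-sided limits and integration by parts across the lattice. -/

/-- An integrable derivative has a primitive continuous up to the endpoints, so `f` has one-sided
limits there. -/
theorem exists_eq_primitive {f f' : ℝ → ℝ} {a b : ℝ} (hab : a < b)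
    (hd : ∀ x ∈ Set.Ioo a b, HasDerivAt f (f' x) x) (hi : IntervalIntegrable f' volume a b) :
    ∃ F : ℝ → ℝ, ContinuousOn F (Set.Icc a b) ∧ Set.EqOn f F (Set.Ioo a b) := by
  set c := (a + b) / 2 with hc
  have hcm : c ∈ Set.Ioo a b := ⟨by linarith, by linarith⟩
  refine ⟨fun x => f c + ∫ t in c..x, f' t, ?_, fun x hx => ?_⟩
  · have h1 := intervalIntegral.continuousOn_primitive_interval' hi
      (a := c) (by rw [Set.uIcc_of_le hab.le]; exact Set.Ioo_subset_Icc_self hcm)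
    rw [Set.uIcc_of_le hab.le] at h1
    exact continuousOn_const.add h1
  · have hsub : Set.uIcc c x ⊆ Set.Ioo a b := Set.ordConnected_Ioo.uIcc_subset hcm hx
    have h1 := intervalIntegral.integral_eq_sub_of_hasDerivAt (f := f) (f' := f') (a := c) (b := x)
      (fun y hy => hd y (hsub hy))
      (hi.mono_set (hsub.trans (by rw [Set.uIcc_of_le hab.le]; exact Set.Ioo_subset_Icc_self)))
    beta_reduce
    rw [h1]
    ring

theorem exists_tendsto_nhdsGT {f f' : ℝ → ℝ} {a b : ℝ} (hab : a < b)
    (hd : ∀ x ∈ Set.Ioo a b, HasDerivAt f (f' x) x) (hi : IntervalIntegrable f' volume a b) :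
    ∃ l, Tendsto f (𝓝[>] a) (𝓝 l) := by
  obtain ⟨F, hF, hfF⟩ := exists_eq_primitive hab hd hi
  refine ⟨F a, ?_⟩
  rw [← nhdsWithin_Ioo_eq_nhdsGT hab]
  refine Tendsto.congr' (f₁ := F) ?_
    ((hF a (Set.left_mem_Icc.2 hab.le)).mono_left (nhdsWithin_mono _ Set.Ioo_subset_Icc_self))
  filter_upwards [self_mem_nhdsWithin] with x hx using (hfF hx).symm

theorem exists_tendsto_nhdsLT {f f' : ℝ → ℝ} {a b : ℝ} (hab : a < b)
    (hd : ∀ x ∈ Set.Ioo a b, HasDerivAt f (f' x) x) (hi : IntervalIntegrable f' volume a b) :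
    ∃ l, Tendsto f (𝓝[<] b) (𝓝 l) := by
  obtain ⟨F, hF, hfF⟩ := exists_eq_primitive hab hd hi
  refine ⟨F b, ?_⟩
  rw [← nhdsWithin_Ioo_eq_nhdsLT hab]
  refine Tendsto.congr' (f₁ := F) ?_
    ((hF b (Set.right_mem_Icc.2 hab.le)).mono_left (nhdsWithin_mono _ Set.Ioo_subset_Icc_self))
  filter_upwards [self_mem_nhdsWithin] with x hx using (hfF hx).symm

theorem notMem_latticeTwoPi_of_mem_Ioo {j : ℤ} {x : ℝ}
    (hx : x ∈ Set.Ioo (2 * Real.pi * (j : ℝ)) (2 * Real.pi * (j + 1 : ℤ))) : x ∉ latticeTwoPi := by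
  rintro ⟨n, rfl⟩
  have hp : (0 : ℝ) < 2 * Real.pi := by positivity
  have h1 : j < n := by exact_mod_cast lt_of_mul_lt_mul_left hx.1 hp.le
  have h2 : n < j + 1 := by exact_mod_cast lt_of_mul_lt_mul_left hx.2 hp.le
  omega

theorem two_pi_mul_lt (j : ℤ) : 2 * Real.pi * (j : ℝ) < 2 * Real.pi * (j + 1 : ℤ) := by
  have hp : (0 : ℝ) < 2 * Real.pi := by positivity
  push_cast
  linarith

theorem hasSum_integral_cells {E : Type*} [NormedAddCommGroup E] [NormedSpace ℝ E]
    {h : ℝ → E} (hi : Integrable h) :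
    HasSum (fun j : ℤ => ∫ u in (2 * Real.pi * (j : ℝ))..(2 * Real.pi * (j + 1 : ℤ)), h u)
      (∫ x, h x) := by
  have hp : (0 : ℝ) < 2 * Real.pi := by positivity
  have h1 := hasSum_integral_iUnion (f := h) (μ := volume) (fun n : ℤ => measurableSet_Ioc)
    (Set.pairwise_disjoint_Ioc_add_zsmul (0 : ℝ) (2 * Real.pi))
    (by rw [iUnion_Ioc_add_zsmul hp]; exact hi.integrableOn)
  rw [iUnion_Ioc_add_zsmul hp, setIntegral_univ] at h1
  convert h1 using 2 with j
  rw [intervalIntegral.integral_of_le (two_pi_mul_lt j).le]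
  simp only [zsmul_eq_mul, zero_add, mul_comm]

namespace InterpolatingConditions

theorem norm_fundamentalHat_le_of_near (h : InterpolatingConditions φ g) {M : ℤ → ℝ}
    (hM : ∀ j : ℤ, ∀ u ∈ Set.Icc (-Real.pi) Real.pi, u ≠ 0 → ratio g j u ≤ M j) (j : ℤ) {ξ : ℝ}
    (h1 : ξ ∈ Set.Icc (2 * Real.pi * j - Real.pi) (2 * Real.pi * j + Real.pi))
    (h0 : ξ ≠ 2 * Real.pi * j) : ‖fundamentalHat g ξ‖ ≤ invSqrtTwoPi * M j := by
  set u := ξ - 2 * Real.pi * j with hu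
  have hξ : ξ = u + 2 * Real.pi * j := by rw [hu]; ring
  have hu1 : u ∈ Set.Icc (-Real.pi) Real.pi := ⟨by linarith [h1.1], by linarith [h1.2]⟩
  have hu0 : u ≠ 0 := sub_ne_zero.2 h0
  have hu' := mt (add_mem_latticeTwoPi_iff j).1 (notMem_latticeTwoPi hu1 hu0)
  rw [hξ, Real.norm_of_nonneg (h.fundamentalHat_nonneg hu')]
  exact (h.fundamentalHat_add_le j hu1 hu0).trans
    (mul_le_mul_of_nonneg_left (hM j u hu1 hu0) invSqrtTwoPi_pos.le)

/-- Nothing forces the transform to be continuous at `2πj`. Its one-sided limits still exist because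
the derivative is integrable, and the bound valid near `2πj` passes to the limit. -/
theorem exists_limit_right (h : InterpolatingConditions φ g) {M : ℤ → ℝ}
    (hM : ∀ j : ℤ, ∀ u ∈ Set.Icc (-Real.pi) Real.pi, u ≠ 0 → ratio g j u ≤ M j)
    (hi : Integrable (fundamentalHatDeriv g)) (j : ℤ) :
    ∃ l : ℝ, Tendsto (fundamentalHat g) (𝓝[>] (2 * Real.pi * j)) (𝓝 l) ∧
      ‖l‖ ≤ invSqrtTwoPi * M j := by
  obtain ⟨l, hl⟩ := exists_tendsto_nhdsGT (two_pi_mul_lt j)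
    (fun x hx => h.hasDerivAt_fundamentalHat (notMem_latticeTwoPi_of_mem_Ioo hx))
    hi.intervalIntegrable
  refine ⟨l, hl, le_of_tendsto hl.norm ?_⟩
  have hpi := Real.pi_pos
  filter_upwards [Ioo_mem_nhdsGT (show 2 * Real.pi * (j : ℝ) < 2 * Real.pi * j + Real.pi by linarith)]
    with ξ hξ
  exact h.norm_fundamentalHat_le_of_near hM j ⟨by linarith [hξ.1], hξ.2.le⟩ hξ.1.ne'

theorem exists_limit_left (h : InterpolatingConditions φ g) {M : ℤ → ℝ}
    (hM : ∀ j : ℤ, ∀ u ∈ Set.Icc (-Real.pi) Real.pi, u ≠ 0 → ratio g j u ≤ M j)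
    (hi : Integrable (fundamentalHatDeriv g)) (j : ℤ) :
    ∃ l : ℝ, Tendsto (fundamentalHat g) (𝓝[<] (2 * Real.pi * j)) (𝓝 l) ∧
      ‖l‖ ≤ invSqrtTwoPi * M j := by
  obtain ⟨l, hl⟩ := exists_tendsto_nhdsLT (two_pi_mul_lt (j - 1))
    (fun x hx => h.hasDerivAt_fundamentalHat (notMem_latticeTwoPi_of_mem_Ioo hx))
    hi.intervalIntegrable
  rw [sub_add_cancel] at hl
  refine ⟨l, hl, le_of_tendsto hl.norm ?_⟩
  have hpi := Real.pi_pos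
  filter_upwards [Ioo_mem_nhdsLT (show 2 * Real.pi * (j : ℝ) - Real.pi < 2 * Real.pi * j by linarith)]
    with ξ hξ
  exact h.norm_fundamentalHat_le_of_near hM j ⟨hξ.1.le, by linarith [hξ.2]⟩ hξ.2.ne

/-- Integration by parts on the intervals between consecutive points of `2πℤ`. -/
theorem exists_integral_fundamentalHat_eq (h : InterpolatingConditions φ g) {M : ℤ → ℝ}
    (hMs : Summable M)
    (hM : ∀ j : ℤ, ∀ u ∈ Set.Icc (-Real.pi) Real.pi, u ≠ 0 → ratio g j u ≤ M j)
    (hi : Integrable (fundamentalHatDeriv g)) :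
    ∃ b₁ b₂ : ℤ → ℝ, (∀ j, ‖b₁ j‖ ≤ invSqrtTwoPi * M j) ∧ (∀ j, ‖b₂ j‖ ≤ invSqrtTwoPi * M j) ∧
      ∀ x : ℝ, Complex.I * x *
          ∫ ξ : ℝ, (fundamentalHat g ξ : ℂ) * Complex.exp (Complex.I * x * ξ) =
        ∑' j : ℤ, (b₁ j : ℂ) * Complex.exp (Complex.I * x * (2 * Real.pi * j : ℝ)) -
        ∑' j : ℤ, (b₂ j : ℂ) * Complex.exp (Complex.I * x * (2 * Real.pi * j : ℝ)) -
        ∫ ξ : ℝ, (fundamentalHatDeriv g ξ : ℂ) * Complex.exp (Complex.I * x * ξ) := by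
  choose b₁ hb₁ hb₁M using h.exists_limit_left hM hi
  choose b₂ hb₂ hb₂M using h.exists_limit_right hM hi
  refine ⟨b₁, b₂, hb₁M, hb₂M, fun x => ?_⟩
  set e : ℝ → ℂ := fun ξ => Complex.exp (Complex.I * x * ξ) with he
  have hec : Continuous e := by fun_prop
  have hi1 := h.integrable_fundamentalHat_mul_exp hMs hM x
  have hi2 : Integrable fun ξ : ℝ => (fundamentalHatDeriv g ξ : ℂ) * e ξ := by
    refine hi.mono (hi.ofReal.1.mul hec.aestronglyMeasurable) (ae_of_all _ fun ξ => ?_)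
    rw [norm_mul, norm_exp_I_mul_mul, mul_one, Complex.norm_real]
  have hi3 : Integrable fun ξ : ℝ => (fundamentalHatDeriv g ξ : ℂ) * e ξ +
      (fundamentalHat g ξ : ℂ) * (e ξ * (Complex.I * x)) := by
    refine hi2.add ((hi1.mul_const (Complex.I * x)).congr (ae_of_all _ fun ξ => ?_))
    simp only [he]
    ring
  -- The fundamental theorem of calculus in its form with endpoint limits, so the values at lattice
  -- points play no role.
  have hcell : ∀ j : ℤ, ∫ ξ in (2 * Real.pi * (j : ℝ))..(2 * Real.pi * (j + 1 : ℤ)),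
      ((fundamentalHatDeriv g ξ : ℂ) * e ξ + (fundamentalHat g ξ : ℂ) * (e ξ * (Complex.I * x))) =
      (b₁ (j + 1) : ℂ) * e (2 * Real.pi * (j + 1 : ℤ)) - (b₂ j : ℂ) * e (2 * Real.pi * j) := by
    intro j
    refine intervalIntegral.integral_eq_sub_of_hasDerivAt_of_tendsto
      (f := fun ξ => (fundamentalHat g ξ : ℂ) * e ξ) (two_pi_mul_lt j) (fun ξ hξ => ?_)
      hi3.intervalIntegrable ?_ ?_
    · have h1 := (h.hasDerivAt_fundamentalHat (notMem_latticeTwoPi_of_mem_Ioo hξ)).ofReal_comp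
      have h2 : HasDerivAt e (e ξ * (Complex.I * x)) ξ := by
        have h3 : HasDerivAt (fun ξ : ℝ => Complex.I * x * (ξ : ℂ)) (Complex.I * x) ξ := by
          simpa using (Complex.ofRealCLM.hasDerivAt (x := ξ)).const_mul (Complex.I * x)
        exact h3.cexp
      exact h1.mul h2
    · exact ((Complex.continuous_ofReal.tendsto _).comp (hb₂ j)).mul
        (hec.continuousAt.mono_left nhdsWithin_le_nhds)
    · exact ((Complex.continuous_ofReal.tendsto _).comp (hb₁ (j + 1))).mul
        (hec.continuousAt.mono_left nhdsWithin_le_nhds)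
  have hs : ∀ b : ℤ → ℝ, (∀ j, ‖b j‖ ≤ invSqrtTwoPi * M j) →
      Summable fun j : ℤ => (b j : ℂ) * e (2 * Real.pi * j) := fun b hb => by
    refine .of_norm_bounded (hMs.mul_left invSqrtTwoPi) fun j => ?_
    rw [norm_mul, norm_exp_I_mul_mul, mul_one, Complex.norm_real]
    exact hb j
  have hsum := hasSum_integral_cells hi3
  simp only [hcell] at hsum
  -- The right end of cell `j` is `2π(j + 1)`; shifting the index attaches each left limit to its
  -- own lattice point.
  have hs1 : HasSum (fun j : ℤ => (b₁ (j + 1) : ℂ) * e (2 * Real.pi * (j + 1 : ℤ)))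
      (∑' j : ℤ, (b₁ j : ℂ) * e (2 * Real.pi * j)) :=
    (Equiv.addRight (1 : ℤ)).hasSum_iff.2 (hs b₁ hb₁M).hasSum
  have heq := hsum.unique (hs1.sub (hs b₂ hb₂M).hasSum)
  have hsplit : ∫ ξ : ℝ, ((fundamentalHatDeriv g ξ : ℂ) * e ξ +
      (fundamentalHat g ξ : ℂ) * (e ξ * (Complex.I * x))) =
      (∫ ξ : ℝ, (fundamentalHatDeriv g ξ : ℂ) * e ξ) +
        Complex.I * x * ∫ ξ : ℝ, (fundamentalHat g ξ : ℂ) * e ξ := by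
    have hi4 : Integrable fun ξ : ℝ => (fundamentalHat g ξ : ℂ) * (e ξ * (Complex.I * x)) := by
      refine (hi1.mul_const (Complex.I * x)).congr (ae_of_all _ fun ξ => ?_)
      simp only [he]
      ring
    rw [integral_add hi2 hi4, ← integral_const_mul]
    congr 2
    funext ξ
    ring
  rw [hsplit] at heq
  linear_combination heq

/-- Multiplying the integration by parts formula by `-i (2π)^(-1/2)` presents `x L(x)` as the
transform of a finite measure. Its mass bounds depend only on `C` and `∑ M j`, which gives
uniformity over the family. -/
theorem exists_mul_fundamental_eq (h : InterpolatingConditions φ g) {M : ℤ → ℝ} (hMs : Summable M)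
    (hM : ∀ j : ℤ, ∀ u ∈ Set.Icc (-Real.pi) Real.pi, u ≠ 0 → ratio g j u ≤ M j)
    {C : ℝ≥0∞} (hCt : C ≠ ⊤)
    (hC : ∑' j : ℤ, ∑' k : {k : ℤ // k ≠ j}, ∫⁻ u in Set.Icc (-Real.pi) Real.pi,
        ‖ratio g j u * derivRatio g k u‖ₑ ≤ C) :
    ∃ (w : ℝ → ℂ) (b₁ b₂ : ℤ → ℂ), Integrable w ∧ Summable b₁ ∧ Summable b₂ ∧
      ∫⁻ ξ, ‖w ξ‖ₑ ≤ C + C ∧ ∑' j, ‖b₁ j‖ₑ ≤ ENNReal.ofReal (∑' j, M j) ∧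
      ∑' j, ‖b₂ j‖ₑ ≤ ENNReal.ofReal (∑' j, M j) ∧
      ∀ x : ℝ, (x : ℂ) * fundamental g x =
        ∑' j : ℤ, b₁ j * Complex.exp (Complex.I * x * (2 * Real.pi * j : ℝ)) +
        ∑' j : ℤ, b₂ j * Complex.exp (Complex.I * x * (2 * Real.pi * j : ℝ)) +
        ∫ ξ : ℝ, w ξ * Complex.exp (Complex.I * x * ξ) := by
  have hi := h.integrable_fundamentalHatDeriv hCt hC
  obtain ⟨b₁, b₂, hb₁, hb₂, hrep⟩ := h.exists_integral_fundamentalHat_eq hMs hM hi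
  have hκ := invSqrtTwoPi_pos
  have hκ1 : invSqrtTwoPi ≤ 1 := by
    have := invSqrtTwoPi_mul_self
    nlinarith [Real.pi_gt_three]
  have hM0 := h.dominant_nonneg hM
  have hκe : ‖(invSqrtTwoPi : ℂ)‖ₑ ≤ 1 := by
    rw [← ofReal_norm, Complex.norm_real, Real.norm_of_nonneg hκ.le, ENNReal.ofReal_le_one]
    exact hκ1
  have hb : ∀ b : ℤ → ℝ, (∀ j, ‖b j‖ ≤ invSqrtTwoPi * M j) → ∀ a : ℂ, ‖a‖ = 1 →
      (Summable fun j => a * invSqrtTwoPi * b j) ∧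
        ∑' j, ‖a * invSqrtTwoPi * (b j : ℂ)‖ₑ ≤ ENNReal.ofReal (∑' j, M j) := fun b hb a ha => by
    have hle : ∀ j, ‖a * invSqrtTwoPi * (b j : ℂ)‖ ≤ M j := fun j => by
      rw [norm_mul, norm_mul, ha, one_mul, Complex.norm_real, Complex.norm_real,
        Real.norm_of_nonneg hκ.le]
      have h1 := hb j
      have h2 : ‖b j‖ ≤ M j := h1.trans (mul_le_of_le_one_left (hM0 j) hκ1)
      exact (mul_le_of_le_one_left (norm_nonneg _) hκ1).trans h2
    refine ⟨.of_norm_bounded hMs hle, ?_⟩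
    rw [ENNReal.ofReal_tsum_of_nonneg hM0 hMs]
    refine ENNReal.tsum_le_tsum fun j => ?_
    rw [← ofReal_norm]
    exact ENNReal.ofReal_le_ofReal (hle j)
  obtain ⟨hs1, hl1⟩ := hb b₁ hb₁ (-Complex.I) (by simp)
  obtain ⟨hs2, hl2⟩ := hb b₂ hb₂ Complex.I (by simp)
  refine ⟨fun ξ => Complex.I * invSqrtTwoPi * fundamentalHatDeriv g ξ, _, _,
    hi.ofReal.const_mul _, hs1, hs2, ?_, hl1, hl2, fun x => ?_⟩
  · calc ∫⁻ ξ, ‖Complex.I * invSqrtTwoPi * (fundamentalHatDeriv g ξ : ℂ)‖ₑ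
        ≤ ∫⁻ ξ, ‖fundamentalHatDeriv g ξ‖ₑ := by
          refine lintegral_mono fun ξ => ?_
          rw [enorm_mul, enorm_mul]
          have : ‖(fundamentalHatDeriv g ξ : ℂ)‖ₑ = ‖fundamentalHatDeriv g ξ‖ₑ := by
            rw [← ofReal_norm, Complex.norm_real, ofReal_norm]
          rw [this]
          refine mul_le_of_le_one_left zero_le ?_
          rw [← ofReal_norm, Complex.norm_I, ENNReal.ofReal_one, one_mul]
          exact hκe
      _ ≤ ENNReal.ofReal invSqrtTwoPi * (C + C) := h.lintegral_fundamentalHatDeriv_le hC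
      _ ≤ C + C := mul_le_of_le_one_left zero_le (ENNReal.ofReal_le_one.2 hκ1)
  · have hx := hrep x
    simp only [mul_assoc (_ * _)]
    simp only [integral_const_mul, tsum_mul_left]
    change (x : ℂ) * ((invSqrtTwoPi : ℂ) * _) = _
    linear_combination (-Complex.I * invSqrtTwoPi) * hx +
      ((x : ℂ) * invSqrtTwoPi * ∫ ξ : ℝ, (fundamentalHat g ξ : ℂ) * Complex.exp (Complex.I * x * ξ)) *
        Complex.I_sq

end InterpolatingConditions

/-! ### Uniform bounds for the fundamental functions. -/

theorem measurable_tsum_exp {b : ℤ → ℂ} (hb : Summable b) (θ : ℤ → ℝ) :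
    Measurable fun x : ℝ => ∑' j, b j * Complex.exp (Complex.I * x * θ j) := by
  refine (continuous_tsum (u := fun j => ‖b j‖) (fun j => by fun_prop) hb.norm fun j x => ?_).measurable
  rw [norm_mul, norm_exp_I_mul_mul, mul_one]

theorem exists_uniform_kernelBound {r : ℝ} (h1 : 1 < r) {M : ℤ → ℝ} (hMs : Summable M) {C : ℝ≥0∞}
    (hCt : C ≠ ⊤) : ∃ c : ℝ≥0∞, c ≠ ⊤ ∧ ∀ φ g : ℝ → ℝ, InterpolatingConditions φ g →
      (∀ j : ℤ, ∀ u ∈ Set.Icc (-Real.pi) Real.pi, u ≠ 0 → ratio g j u ≤ M j) →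
      (∑' j : ℤ, ∑' k : {k : ℤ // k ≠ j}, ∫⁻ u in Set.Icc (-Real.pi) Real.pi,
        ‖ratio g j u * derivRatio g k u‖ₑ ≤ C) → KernelBound r (fundamental g) c := by
  obtain ⟨c, hc, hH⟩ := exists_kernelBound_conjBump h1
  set m := ENNReal.ofReal (∑' j, M j) with hm
  have hr0 : 0 ≤ r := by linarith
  have h2 : (2 : ℝ≥0∞) ^ (r - 1) ≠ ⊤ := ENNReal.rpow_ne_top_of_nonneg (by linarith) (by simp)
  have hmc : m ^ r * c ≠ ⊤ :=
    ENNReal.mul_ne_top (ENNReal.rpow_ne_top_of_nonneg hr0 ENNReal.ofReal_ne_top) hc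
  have hCc : (C + C) ^ r * c ≠ ⊤ :=
    ENNReal.mul_ne_top (ENNReal.rpow_ne_top_of_nonneg hr0 (ENNReal.add_ne_top.2 ⟨hCt, hCt⟩)) hc
  refine ⟨2 ^ (r - 1) * (m ^ r * youngConst r +
    2 ^ (r - 1) * (2 ^ (r - 1) * (m ^ r * c + m ^ r * c) + (C + C) ^ r * c)), ?_, ?_⟩
  · refine ENNReal.mul_ne_top h2 (ENNReal.add_ne_top.2 ⟨ENNReal.mul_ne_top
      (ENNReal.rpow_ne_top_of_nonneg hr0 ENNReal.ofReal_ne_top) (youngConst_ne_top h1), ?_⟩)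
    refine ENNReal.mul_ne_top h2 (ENNReal.add_ne_top.2 ⟨ENNReal.mul_ne_top h2 ?_, hCc⟩)
    exact ENNReal.add_ne_top.2 ⟨hmc, hmc⟩
  · intro φ g h hM hC
    obtain ⟨w, b₁, b₂, hw, hb₁, hb₂, hwC, hb₁M, hb₂M, hrep⟩ :=
      h.exists_mul_fundamental_eq hMs hM hCt hC
    have k1 := (hH.mul_tsum_exp h1 measurable_ofReal_conjBump hb₁
      (fun j => 2 * Real.pi * j)).mono (d := m ^ r * c) (by gcongr)
    have k2 := (hH.mul_tsum_exp h1 measurable_ofReal_conjBump hb₂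
      (fun j => 2 * Real.pi * j)).mono (d := m ^ r * c) (by gcongr)
    have k3 := (hH.mul_integral_exp h1 measurable_ofReal_conjBump hw
      (θ := fun ξ => ξ) measurable_id).mono (d := (C + C) ^ r * c) (by gcongr)
    have m1 := measurable_ofReal_conjBump.mul (measurable_tsum_exp hb₁ fun j => 2 * Real.pi * j)
    have m2 := measurable_ofReal_conjBump.mul (measurable_tsum_exp hb₂ fun j => 2 * Real.pi * j)
    have k4 := (k1.add h1 m1 k2).add h1 (m1.add m2) k3
    refine kernelBound_of_mul_id h1 (h.continuous_fundamental hMs hM).measurable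
      (h.norm_fundamental_le hMs hM) ?_
    convert k4 using 2 with x
    simp only [Pi.add_apply, Pi.mul_apply]
    rw [hrep]
    ring

namespace InterpolatingConditions

theorem abs_mul_norm_fundamental_le (h : InterpolatingConditions φ g) {M : ℤ → ℝ} (hMs : Summable M)
    (hM : ∀ j : ℤ, ∀ u ∈ Set.Icc (-Real.pi) Real.pi, u ≠ 0 → ratio g j u ≤ M j)
    {C : ℝ≥0∞} (hCt : C ≠ ⊤)
    (hC : ∑' j : ℤ, ∑' k : {k : ℤ // k ≠ j}, ∫⁻ u in Set.Icc (-Real.pi) Real.pi,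
        ‖ratio g j u * derivRatio g k u‖ₑ ≤ C) (x : ℝ) :
    |x| * ‖fundamental g x‖ ≤ (ENNReal.ofReal (∑' j, M j) + ENNReal.ofReal (∑' j, M j) +
      (C + C)).toReal := by
  obtain ⟨w, b₁, b₂, hw, hb₁, hb₂, hwC, hb₁M, hb₂M, hrep⟩ :=
    h.exists_mul_fundamental_eq hMs hM hCt hC
  have key : ‖(x : ℂ) * fundamental g x‖ₑ ≤
      ENNReal.ofReal (∑' j, M j) + ENNReal.ofReal (∑' j, M j) + (C + C) := by
    rw [hrep]
    refine (enorm_add_le _ _).trans (add_le_add ((enorm_add_le _ _).trans (add_le_add ?_ ?_)) ?_)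
    · refine enorm_tsum_le_tsum_enorm.trans ?_
      simpa only [enorm_mul, enorm_exp_I_mul_mul, mul_one] using hb₁M
    · refine enorm_tsum_le_tsum_enorm.trans ?_
      simpa only [enorm_mul, enorm_exp_I_mul_mul, mul_one] using hb₂M
    · refine (enorm_integral_le_lintegral_enorm _).trans ?_
      simpa only [enorm_mul, enorm_exp_I_mul_mul, mul_one] using hwC
  rw [← Real.norm_eq_abs, ← Complex.norm_real, ← norm_mul, ← toReal_enorm]
  exact ENNReal.toReal_mono (by simp [hCt]) key

end InterpolatingConditions

/-! ### Pointwise convergence to the cardinal sine. -/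

theorem integral_exp_Icc (x : ℝ) :
    (invSqrtTwoPi : ℂ) * ∫ u in Set.Icc (-Real.pi) Real.pi,
      (invSqrtTwoPi : ℂ) * Complex.exp (Complex.I * x * u) = cardinalSinc x := by
  have hpi := Real.pi_pos
  have hκ : (invSqrtTwoPi : ℂ) * invSqrtTwoPi * (2 * Real.pi) = 1 := by
    exact_mod_cast invSqrtTwoPi_mul_self
  rw [integral_const_mul, integral_Icc_eq_integral_Ioc,
    ← intervalIntegral.integral_of_le (by linarith : -Real.pi ≤ Real.pi), cardinalSinc]
  rcases eq_or_ne x 0 with rfl | hx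
  · simp
    linear_combination hκ
  · have hx' : (x : ℂ) ≠ 0 := by exact_mod_cast hx
    have hpi' : (Real.pi : ℂ) ≠ 0 := by exact_mod_cast hpi.ne'
    rw [integral_exp_mul_complex (mul_ne_zero Complex.I_ne_zero hx'),
      Real.sinc_of_ne_zero (by positivity)]
    have hsin : Complex.exp (Complex.I * x * Real.pi) - Complex.exp (Complex.I * x * (-Real.pi : ℝ)) =
        2 * Complex.I * Complex.sin (Real.pi * x) := by
      rw [Complex.sin, show Complex.I * x * (-Real.pi : ℝ) = -(Real.pi * x) * Complex.I by
        push_cast; ring, show Complex.I * x * Real.pi = Real.pi * x * Complex.I by ring]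
      linear_combination (Complex.exp (Real.pi * x * Complex.I) -
        Complex.exp (-(Real.pi * x) * Complex.I)) * Complex.I_sq
    rw [hsin]
    push_cast
    field_simp
    linear_combination Complex.sin (Real.pi * x) * hκ

/-- By (B3) the transforms tend a.e. to `(2π)^(-1/2)` times the indicator of `[-π, π]`. Dominated
convergence with majorant `M` is used for the sum of ratios, for the integral over each cell, and
for the sum over cells. -/
theorem tendsto_fundamental {A : Set ℝ} {φ φhat : ℝ → ℝ → ℝ} (hφ : SplineLikeFamily A φ φhat)
    {M : ℤ → ℝ} (hMs : Summable M)
    (hM : ∀ α ∈ A, ∀ j : ℤ, ∀ u ∈ Set.Icc (-Real.pi) Real.pi, u ≠ 0 → ratio (φhat α) j u ≤ M j)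
    (x : ℝ) :
    Tendsto (fun α => fundamental (φhat α) x) (atTop ⊓ 𝓟 A) (𝓝 (cardinalSinc x)) := by
  set l : Filter ℝ := atTop ⊓ 𝓟 A with hl
  have hA : ∀ᶠ α in l, α ∈ A := mem_inf_of_right (mem_principal_self A)
  have hκ := invSqrtTwoPi_pos
  set e : ℝ → ℂ := fun ξ => Complex.exp (Complex.I * x * ξ) with he
  have hec : Continuous e := by fun_prop
  have hratio : ∀ᵐ u ∂(volume.restrict (Set.Icc (-Real.pi) Real.pi)), ∀ j : ℤ,
      Tendsto (fun α => ratio (φhat α) j u) l (𝓝 (if j = 0 then 1 else 0)) := by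
    rw [ae_all_iff]
    intro j
    rcases eq_or_ne j 0 with rfl | hj
    · filter_upwards [InterpolatingConditions.ae_ne_zero_Icc] with u hu
      rw [if_pos rfl]
      refine tendsto_const_nhds.congr' ?_
      filter_upwards [hA] with α hα
      have := ((hφ.interpolating α hα).pos hu.1 hu.2).ne'
      simp [ratio, this]
    · rw [if_neg hj]
      exact hφ.ratio_tendsto j hj
  have hper : ∀ᵐ u ∂(volume.restrict (Set.Icc (-Real.pi) Real.pi)), ∀ j : ℤ,
      Tendsto (fun α => fundamentalHat (φhat α) (u + 2 * Real.pi * j)) l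
        (𝓝 (if j = 0 then invSqrtTwoPi else 0)) := by
    filter_upwards [hratio, InterpolatingConditions.ae_ne_zero_Icc] with u hu hu' j
    -- This sum is the periodization divided by `φhat α u`; only `k = 0` survives in the limit.
    have hsum : Tendsto (fun α => ∑' k : ℤ, ratio (φhat α) k u) l (𝓝 1) := by
      have := tendsto_tsum_of_dominated_convergence (bound := M) hMs hu (by
        filter_upwards [hA] with α hα k
        rw [Real.norm_of_nonneg ((hφ.interpolating α hα).ratio_nonneg k hu'.1 hu'.2)]
        exact hM α hα k u hu'.1 hu'.2)
      rwa [tsum_ite_eq] at this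
    have h2 := (((hu j).mul (hsum.inv₀ one_ne_zero)).const_mul invSqrtTwoPi).congr' (f₂ :=
      fun α => fundamentalHat (φhat α) (u + 2 * Real.pi * j)) (by
        filter_upwards [hA] with α hα
        rw [(hφ.interpolating α hα).fundamentalHat_add_eq j hu'.1 hu'.2]
        congr 2
        simp only [ratio]
        rw [tsum_div_const, inv_div]
        rfl)
    convert h2 using 2
    split_ifs <;> simp
  have hterm : ∀ j : ℤ, Tendsto (fun α => ∫ u in Set.Icc (-Real.pi) Real.pi,
      (fundamentalHat (φhat α) (u + 2 * Real.pi * j) : ℂ) * e (u + 2 * Real.pi * j)) l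
      (𝓝 (∫ u in Set.Icc (-Real.pi) Real.pi,
        ((if j = 0 then invSqrtTwoPi else 0 : ℝ) : ℂ) * e (u + 2 * Real.pi * j))) := by
    intro j
    refine tendsto_integral_filter_of_dominated_convergence (fun _ => invSqrtTwoPi * M j) ?_ ?_
      (integrable_const _) ?_
    · filter_upwards [hA] with α hα
      have h1 := ((hφ.interpolating α hα).integrable_fundamentalHat_mul_exp hMs (hM α hα) x).1
      exact (h1.comp_measurePreserving
        (measurePreserving_add_right volume (2 * Real.pi * (j : ℝ)))).restrict
    · filter_upwards [hA] with α hα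
      filter_upwards [InterpolatingConditions.ae_ne_zero_Icc] with u hu
      have h := hφ.interpolating α hα
      have hu' := mt (add_mem_latticeTwoPi_iff j).1 (notMem_latticeTwoPi hu.1 hu.2)
      rw [norm_mul, norm_exp_I_mul_mul, mul_one, Complex.norm_real,
        Real.norm_of_nonneg (h.fundamentalHat_nonneg hu')]
      exact (h.fundamentalHat_add_le j hu.1 hu.2).trans
        (mul_le_mul_of_nonneg_left (hM α hα j u hu.1 hu.2) hκ.le)
    · filter_upwards [hper] with u hu
      exact ((Complex.continuous_ofReal.tendsto _).comp (hu j)).mul_const _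
  have hlim := tendsto_tsum_of_dominated_convergence
    (bound := fun j => invSqrtTwoPi * M j * (2 * Real.pi)) ((hMs.mul_left _).mul_right _) hterm (by
      filter_upwards [hA] with α hα j
      have h := hφ.interpolating α hα
      have hb : ∀ᵐ u ∂(volume.restrict (Set.Icc (-Real.pi) Real.pi)),
          ‖(fundamentalHat (φhat α) (u + 2 * Real.pi * j) : ℂ) * e (u + 2 * Real.pi * j)‖ ≤
            invSqrtTwoPi * M j := by
        filter_upwards [InterpolatingConditions.ae_ne_zero_Icc] with u hu
        have hu' := mt (add_mem_latticeTwoPi_iff j).1 (notMem_latticeTwoPi hu.1 hu.2)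
        rw [norm_mul, norm_exp_I_mul_mul, mul_one, Complex.norm_real,
          Real.norm_of_nonneg (h.fundamentalHat_nonneg hu')]
        exact (h.fundamentalHat_add_le j hu.1 hu.2).trans
          (mul_le_mul_of_nonneg_left (hM α hα j u hu.1 hu.2) hκ.le)
      refine (norm_integral_le_of_norm_le_const hb).trans (le_of_eq ?_)
      rw [measureReal_restrict_apply_univ, Real.volume_real_Icc_of_le (by linarith [Real.pi_pos])]
      ring)
  have hval : ∑' j : ℤ, ∫ u in Set.Icc (-Real.pi) Real.pi,
      ((if j = 0 then invSqrtTwoPi else 0 : ℝ) : ℂ) * e (u + 2 * Real.pi * j) =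
      ∫ u in Set.Icc (-Real.pi) Real.pi, (invSqrtTwoPi : ℂ) * e u := by
    rw [tsum_eq_single 0 fun j hj => by simp [hj]]
    simp
  rw [hval] at hlim
  rw [← integral_exp_Icc]
  refine (hlim.const_mul (invSqrtTwoPi : ℂ)).congr' ?_
  filter_upwards [hA] with α hα
  rw [(hasSum_integral_translates
    ((hφ.interpolating α hα).integrable_fundamentalHat_mul_exp hMs (hM α hα) x)).tsum_eq]
  rfl

theorem exists_dominant {A : Set ℝ} {φ φhat : ℝ → ℝ → ℝ} (hφ : SplineLikeFamily A φ φhat) :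
    ∃ M : ℤ → ℝ, Summable M ∧ ∀ α ∈ A, ∀ j : ℤ, ∀ u ∈ Set.Icc (-Real.pi) Real.pi, u ≠ 0 →
      ratio (φhat α) j u ≤ M j := by
  obtain ⟨M, hMs, hM⟩ := hφ.ratio_dominated
  -- (B4) says nothing about `M 0`; the value 1 is right because the ratio with `j = 0` is
  -- identically 1.
  refine ⟨Function.update M 0 1, hMs.update 0 1, fun α hα j u hu h0 => ?_⟩
  rcases eq_or_ne j 0 with rfl | hj
  · have := ((hφ.interpolating α hα).pos hu h0).ne'
    simp [ratio, this]
  · rw [Function.update_of_ne hj]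
    exact hM j hj α hα u hu h0

/-! ### Strong convergence in `L^p`. -/

theorem KernelBound.neg {r : ℝ} {K : ℝ → ℂ} {c : ℝ≥0∞} (h : KernelBound r K c) :
    KernelBound r (fun x => -K x) c := fun S f => by
  simpa only [mul_neg, Finset.sum_neg_distrib, enorm_neg] using h S f

theorem KernelBound.memLp_tsum {p : ℝ≥0∞} (hp0 : p ≠ 0) (hpt : p ≠ ⊤) {L : ℝ → ℂ} {c : ℝ≥0∞}
    (hc : c ≠ ⊤) (h : KernelBound p.toReal L c) (hL : Measurable L) {f : ℤ → ℂ}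
    (hf : ∑' j, ‖f j‖ₑ ^ p.toReal ≠ ⊤)
    (hs : ∀ x : ℝ, Summable fun j : ℤ => f j * L (x - j)) :
    MemLp (fun x : ℝ => ∑' j : ℤ, f j * L (x - j)) p := by
  refine ⟨(measurable_tsum_translates hL hs).aestronglyMeasurable, ?_⟩
  rw [eLpNorm_lt_top_iff_lintegral_rpow_enorm_lt_top hp0 hpt]
  exact (h.lintegral_tsum_le hL hs).trans_lt (ENNReal.mul_lt_top hc.lt_top hf.lt_top)

theorem lintegral_ofReal_rpow_bump_ne_top {r : ℝ} (h1 : 1 < r) {D : ℝ} (hD : 0 ≤ D) :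
    ∫⁻ x, ENNReal.ofReal (D * bump x ^ (1 / 2 : ℝ)) ^ r ≠ ⊤ := by
  have h : ∀ x, ENNReal.ofReal (D * bump x ^ (1 / 2 : ℝ)) ^ r =
      ENNReal.ofReal (D ^ r * bump x ^ (r / 2)) := fun x => by
    have hb := (bump_pos x).le
    rw [ENNReal.ofReal_rpow_of_nonneg (by positivity) (by linarith),
      Real.mul_rpow hD (by positivity), ← Real.rpow_mul hb]
    congr 3
    ring
  simp only [h]
  rw [← ofReal_integral_eq_lintegral_ofReal ((integrable_rpow_bump h1).const_mul _)
    (ae_of_all _ fun x => mul_nonneg (Real.rpow_nonneg hD _) (Real.rpow_nonneg (bump_pos x).le _))]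
  exact ENNReal.ofReal_ne_top

/-- Dominated convergence gives `K i → 0` in `L^p`, and a finite sum of translates is bounded by
Minkowski's inequality and translation invariance. -/
theorem tendsto_eLpNorm_sum_translates {ι : Type*} {l : Filter ι} [l.IsCountablyGenerated]
    {p : ℝ≥0∞} (hp1 : 1 < p) (hpt : p ≠ ⊤) {K : ι → ℝ → ℂ} {D : ℝ} (hD : 0 ≤ D)
    (hKm : ∀ᶠ i in l, Measurable (K i))
    (hKD : ∀ᶠ i in l, ∀ x, ‖K i x‖ ≤ D * bump x ^ (1 / 2 : ℝ))
    (hK0 : ∀ x, Tendsto (fun i => K i x) l (𝓝 0)) (S : Finset ℤ) (f : ℤ → ℂ) :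
    Tendsto (fun i => eLpNorm (fun x : ℝ => ∑ j ∈ S, f j * K i (x - j)) p volume) l (𝓝 0) := by
  have hp0 : p ≠ 0 := (zero_lt_one.trans hp1).ne'
  have hr : 1 < p.toReal := by
    rw [← ENNReal.toReal_one]
    exact (ENNReal.toReal_lt_toReal ENNReal.one_ne_top hpt).2 hp1
  have hr0 : 0 < p.toReal := by linarith
  have hone : Tendsto (fun i => eLpNorm (K i) p volume) l (𝓝 0) := by
    have h1 : Tendsto (fun i => ∫⁻ x, ‖K i x‖ₑ ^ p.toReal) l (𝓝 (∫⁻ _ : ℝ, 0)) := by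
      refine tendsto_lintegral_filter_of_dominated_convergence _
        (hKm.mono fun i hi => hi.enorm.pow_const _) (hKD.mono fun i hi => ae_of_all _ fun x => ?_)
        (lintegral_ofReal_rpow_bump_ne_top hr hD) (ae_of_all _ fun x => ?_)
      · refine ENNReal.rpow_le_rpow ?_ hr0.le
        rw [← ofReal_norm]
        exact ENNReal.ofReal_le_ofReal (hi x)
      · have := (ENNReal.continuous_rpow_const (y := p.toReal)).tendsto _ |>.comp
          ((continuous_enorm.tendsto _).comp (hK0 x))
        simpa [Function.comp_def, hr0] using this
    rw [lintegral_zero] at h1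
    have h2 := (ENNReal.continuous_rpow_const (y := 1 / p.toReal)).tendsto _ |>.comp h1
    rw [ENNReal.zero_rpow_of_pos (by positivity)] at h2
    simpa only [eLpNorm_eq_lintegral_rpow_enorm_toReal hp0 hpt, Function.comp_def] using h2
  have hsum : Tendsto (fun i => ∑ j ∈ S, ‖f j‖ₑ * eLpNorm (K i) p volume) l (𝓝 0) := by
    rw [show (0 : ℝ≥0∞) = ∑ j ∈ S, ‖f j‖ₑ * 0 by simp]
    exact tendsto_finsetSum _ fun j _ => ENNReal.Tendsto.const_mul hone (Or.inr enorm_ne_top)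
  refine tendsto_of_tendsto_of_tendsto_of_le_of_le' tendsto_const_nhds hsum
    (.of_forall fun i => zero_le) ?_
  filter_upwards [hKm] with i hi
  have hm : ∀ j : ℤ, Measurable fun x : ℝ => K i (x - j) := fun j => hi.comp (measurable_id.sub_const _)
  have h1 : (fun x : ℝ => ∑ j ∈ S, f j * K i (x - j)) = ∑ j ∈ S, f j • fun x : ℝ => K i (x - j) := by
    ext x
    simp
  rw [h1]
  refine (eLpNorm_sum_le (fun j _ => ((hm j).const_smul (f j)).aestronglyMeasurable) hp1.le).trans
    (Finset.sum_le_sum fun j _ => ?_)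
  rw [eLpNorm_const_smul]
  gcongr
  exact (eLpNorm_comp_measurePreserving hi.aestronglyMeasurable
    (measurePreserving_sub_right volume (j : ℝ))).le

/-- A family of uniformly bounded operators whose kernels tend to zero, with a common majorant,
tends strongly to zero. -/
theorem tendsto_eLpNorm_tsum_translates {ι : Type*} {l : Filter ι} [l.IsCountablyGenerated]
    {p : ℝ≥0∞} (hp1 : 1 < p) (hpt : p ≠ ⊤) {K : ι → ℝ → ℂ} {D : ℝ} (hD : 0 ≤ D) {c : ℝ≥0∞}
    (hc : c ≠ ⊤) (hKm : ∀ᶠ i in l, Measurable (K i))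
    (hKD : ∀ᶠ i in l, ∀ x, ‖K i x‖ ≤ D * bump x ^ (1 / 2 : ℝ))
    (hKc : ∀ᶠ i in l, KernelBound p.toReal (K i) c)
    (hK0 : ∀ x, Tendsto (fun i => K i x) l (𝓝 0)) {f : ℤ → ℂ}
    (hf : Summable fun j => ‖f j‖ ^ p.toReal) (hft : ∑' j, ‖f j‖ₑ ^ p.toReal ≠ ⊤) :
    Tendsto (fun i => eLpNorm (fun x : ℝ => ∑' j : ℤ, f j * K i (x - j)) p volume) l (𝓝 0) := by
  have hp0 : p ≠ 0 := (zero_lt_one.trans hp1).ne'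
  have hr : 1 < p.toReal := by
    rw [← ENNReal.toReal_one]
    exact (ENNReal.toReal_lt_toReal ENNReal.one_ne_top hpt).2 hp1
  have hr0 : 0 < p.toReal := by linarith
  rw [ENNReal.tendsto_nhds_zero]
  intro ε hε
  have htail : Tendsto (fun S : Finset ℤ =>
      (c * ∑' j : {j // j ∉ S}, ‖f j‖ₑ ^ p.toReal) ^ (1 / p.toReal)) atTop (𝓝 0) := by
    have h1 := ENNReal.Tendsto.const_mul (ENNReal.tendsto_tsum_compl_atTop_zero hft)
      (Or.inr hc)
    have h2 := (ENNReal.continuous_rpow_const (y := 1 / p.toReal)).tendsto _ |>.comp h1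
    rwa [mul_zero, ENNReal.zero_rpow_of_pos (by positivity)] at h2
  have hε2 : ε / 2 > 0 := ENNReal.half_pos hε.ne'
  -- `S` is chosen before `i`: the common bound `c` makes the contribution of the tail of `f` at
  -- most `ε / 2` for all the kernels at once.
  obtain ⟨S, hS⟩ := ((ENNReal.tendsto_nhds_zero.1 htail) (ε / 2) hε2).exists
  set h : ℤ → ℂ := fun j => if j ∈ S then 0 else f j with hh
  have hhsum : ∑' j, ‖h j‖ₑ ^ p.toReal = ∑' j : {j // j ∉ S}, ‖f j‖ₑ ^ p.toReal := by
    refine Eq.trans ?_ (tsum_subtype {j : ℤ | j ∉ S} fun j => ‖f j‖ₑ ^ p.toReal).symm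
    refine tsum_congr fun j => ?_
    by_cases hj : j ∈ S <;> simp [hh, hj, hr0]
  have hhs : Summable fun j => ‖h j‖ ^ p.toReal := by
    refine hf.of_nonneg_of_le (fun j => by positivity) fun j => ?_
    refine Real.rpow_le_rpow (norm_nonneg _) ?_ hr0.le
    by_cases hj : j ∈ S <;> simp [hh, hj]
  filter_upwards [(ENNReal.tendsto_nhds_zero.1
    (tendsto_eLpNorm_sum_translates hp1 hpt hD hKm hKD hK0 S f)) (ε / 2) hε2, hKm, hKD, hKc]
    with i hi1 hi2 hi3 hi4
  have hsf := summable_mul_translate hr hf hi3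
  have hsh := summable_mul_translate hr hhs hi3
  have hsplit : (fun x : ℝ => ∑' j : ℤ, f j * K i (x - j)) =
      (fun x : ℝ => ∑ j ∈ S, f j * K i (x - j)) + fun x : ℝ => ∑' j : ℤ, h j * K i (x - j) := by
    ext x
    have h1 : (fun j : ℤ => f j * K i (x - j)) = fun j : ℤ =>
        (if j ∈ S then f j * K i (x - j) else 0) + h j * K i (x - j) := by
      ext j
      by_cases hj : j ∈ S <;> simp [hh, hj]
    have h2 : HasSum (fun j : ℤ => if j ∈ S then f j * K i (x - j) else 0)
        (∑ j ∈ S, f j * K i (x - j)) := by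
      rw [show ∑ j ∈ S, f j * K i (x - j) = ∑ j ∈ S, if j ∈ S then f j * K i (x - j) else 0 from
        Finset.sum_congr rfl fun j hj => (if_pos hj).symm]
      exact hasSum_sum_of_ne_finset_zero fun j hj => if_neg hj
    rw [h1, Pi.add_apply]
    exact (h2.add (hsh x).hasSum).tsum_eq
  rw [hsplit]
  refine (eLpNorm_add_le (measurable_sum_translates hi2 S f).aestronglyMeasurable
    (measurable_tsum_translates hi2 hsh).aestronglyMeasurable hp1.le).trans ?_
  rw [← ENNReal.add_halves ε]
  refine add_le_add hi1 (le_trans ?_ hS)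
  rw [eLpNorm_eq_lintegral_rpow_enorm_toReal hp0 hpt, ← hhsum]
  exact ENNReal.rpow_le_rpow (hi4.lintegral_tsum_le hi2 hsh) (by positivity)

end

end CardinalInterp

/-- For a spline-like family, `1 < p < ∞` and `f ∈ ℓ^p(ℤ)`: both series converge at every point
and define functions in `L^p(ℝ)`, and the interpolants of `f` converge in `L^p(ℝ)` to the
cardinal sinc series of `f` as `α → ∞` within `A`. -/
theorem proposition2 (A : Set ℝ) (φ φhat : ℝ → ℝ → ℝ)
    (hφ : CardinalInterp.SplineLikeFamily A φ φhat)
    (p : ℝ≥0∞) (hp_one : 1 < p) (hp_top : p < (⊤ : ℝ≥0∞))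
    (f : ℤ → ℂ) (hf : Memℓp f p) :
    (∀ α ∈ A,
      (∀ x : ℝ, Summable fun j : ℤ => f j * CardinalInterp.fundamental (φhat α) (x - j)) ∧
      MemLp (CardinalInterp.interpolant (φhat α) f) p volume) ∧
    (∀ x : ℝ, Summable fun k : ℤ => f k * (Real.sinc (Real.pi * (x - k)) : ℂ)) ∧
    MemLp (CardinalInterp.whittaker f) p volume ∧
    Tendsto
      (fun α : ℝ => eLpNorm
        (fun x : ℝ => CardinalInterp.interpolant (φhat α) f x - CardinalInterp.whittaker f x)
        p volume)
      (atTop ⊓ 𝓟 A) (𝓝 0) := by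
  open CardinalInterp in
  have hp0 : p ≠ 0 := (zero_lt_one.trans hp_one).ne'
  have hpt : p ≠ ⊤ := hp_top.ne
  have hr : 1 < p.toReal := by
    rw [← ENNReal.toReal_one]
    exact (ENNReal.toReal_lt_toReal ENNReal.one_ne_top hpt).2 hp_one
  have hr0 : 0 < p.toReal := by linarith
  have hfs : Summable fun j => ‖f j‖ ^ p.toReal := (memℓp_gen_iff hr0).1 hf
  have hft : ∑' j, ‖f j‖ₑ ^ p.toReal ≠ ⊤ := by
    convert hfs.tsum_ofReal_ne_top using 3 with j
    rw [← ofReal_norm, ENNReal.ofReal_rpow_of_nonneg (norm_nonneg _) hr0.le]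
  obtain ⟨C, hC⟩ := hφ.sum_bound
  obtain ⟨M, hMs, hM⟩ := exists_dominant hφ
  obtain ⟨c, hc, hcK⟩ := exists_uniform_kernelBound hr hMs (C := (C : ℝ≥0∞)) ENNReal.coe_ne_top
  obtain ⟨d, hd, hdK⟩ := exists_kernelBound_cardinalSinc hr
  set B := ∑' j, M j
  set E := (ENNReal.ofReal B + ENNReal.ofReal B + ((C : ℝ≥0∞) + C)).toReal
  have hLD : ∀ α ∈ A, ∀ x, ‖fundamental (φhat α) x‖ ≤ (B + E) * bump x ^ (1 / 2 : ℝ) := fun α hα =>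
    norm_le_mul_sqrt_bump ((hφ.interpolating α hα).norm_fundamental_le hMs (hM α hα))
      ((hφ.interpolating α hα).abs_mul_norm_fundamental_le hMs (hM α hα) ENNReal.coe_ne_top (hC α hα))
  have hSD : ∀ x, ‖cardinalSinc x‖ ≤ (1 + 1) * bump x ^ (1 / 2 : ℝ) :=
    norm_le_mul_sqrt_bump norm_cardinalSinc_le abs_mul_norm_cardinalSinc_le
  have hLm : ∀ α ∈ A, Measurable (fundamental (φhat α)) := fun α hα =>
    ((hφ.interpolating α hα).continuous_fundamental hMs (hM α hα)).measurable
  have hSm := continuous_cardinalSinc.measurable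
  have hLK : ∀ α ∈ A, KernelBound p.toReal (fundamental (φhat α)) c := fun α hα =>
    hcK (φ α) (φhat α) (hφ.interpolating α hα) (hM α hα) (hC α hα)
  have hLs : ∀ α ∈ A, ∀ x : ℝ, Summable fun j : ℤ => f j * fundamental (φhat α) (x - j) :=
    fun α hα => summable_mul_translate hr hfs (hLD α hα)
  have hSs : ∀ x : ℝ, Summable fun j : ℤ => f j * cardinalSinc (x - j) :=
    summable_mul_translate hr hfs hSD
  have hA : ∀ᶠ α in atTop ⊓ 𝓟 A, α ∈ A := mem_inf_of_right (mem_principal_self A)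
  refine ⟨fun α hα => ⟨hLs α hα, (hLK α hα).memLp_tsum hp0 hpt hc (hLm α hα) hft (hLs α hα)⟩, hSs,
    hdK.memLp_tsum hp0 hpt hd hSm hft hSs, ?_⟩
  -- Majorant constant for the difference kernel: `B + E` for the fundamental function and `1 + 1`
  -- for the cardinal sine; the maximum with `0` only secures its sign.
  have hB : 0 ≤ max (B + E + (1 + 1)) 0 := le_max_right _ _
  have hlim := tendsto_eLpNorm_tsum_translates (l := atTop ⊓ 𝓟 A) hp_one hpt
    (K := fun α x => fundamental (φhat α) x + -cardinalSinc x) hB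
    (c := 2 ^ (p.toReal - 1) * (c + d))
    (ENNReal.mul_ne_top (ENNReal.rpow_ne_top_of_nonneg (by linarith) (by simp))
      (ENNReal.add_ne_top.2 ⟨hc, hd⟩))
    (hA.mono fun α hα => (hLm α hα).add hSm.neg)
    (hA.mono fun α hα x => by
      refine (norm_add_le _ _).trans ?_
      rw [norm_neg]
      refine (add_le_add (hLD α hα x) (hSD x)).trans ?_
      rw [← add_mul]
      exact mul_le_mul_of_nonneg_right (le_max_left _ _) (Real.rpow_nonneg (bump_pos x).le _))
    (hA.mono fun α hα => (hLK α hα).add hr (hLm α hα) hdK.neg)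
    (fun x => by
      have := (tendsto_fundamental hφ hMs hM x).add_const (-cardinalSinc x)
      rwa [add_neg_cancel] at this)
    hfs hft
  refine hlim.congr' ?_
  filter_upwards [hA] with α hα
  congr 1
  ext x
  refine Eq.trans ?_ (sub_eq_add_neg _ _).symm
  simp only [mul_add, mul_neg]
  exact ((hLs α hα x).hasSum.add (hSs x).hasSum.neg).tsum_eq
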